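/- **Languages and theories.** Let $\mathcal{L}_{\mathsf{Set}}=\{\in,S,\langle-,-\rangle\}$ with a binary relation symbol $\in$, a unary relation symbol $S$ ("sethood") and a binary function symbol $\langle-,-\rangle$. A formula is *stratified* if one can assign natural numbers (types) to its terms, each variable having one type (bound variables being renamed apart), such that $\langle v,w\rangle$ has the same type as $v$ and as $w$; in every atomic subformula $u=v$ the terms $u,v$ have the same type; and in every atomic subformula $u\in v$ the type of $v$ is one more than the type of $u$. The axioms of $\mathrm{(I)NFU}_{\mathsf{Set}}$ are: * $(S(x)\wedge S(y)\wedge\forall z(z\in x\leftrightarrow z\in y))\to x=y$; * $\exists x\,(S(x)\wedge\forall z(z\in x\leftrightarrow\phi))$ for every stratified $\phi$ in which $x$ is not free (parameters allowed); * $\langle x,y\rangle=\langle x',y'\rangle\to(x=x'\wedge y=y')$; * $z\in x\to S(x)$. $\mathrm{(I)NF}_{\mathsf{Set}}$ has in addition the axiom $\forall x\,S(x)$. Let $\mathcal{L}_{\mathsf{Class}}$ have a binary relation symbol $\in$, unary relation symbols $S$, $C$ ("class") and $\mathrm{Setom}$ ("set or atom"), and a ternary relation symbol, written $\langle x,y\rangle=z$,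 for the graph of a partial pairing function. Stratification is defined as before, where in $\langle x,y\rangle=z$ all three variables have the same type. The axioms of $\mathrm{(I)MLU}_{\mathsf{Class}}$ are: * $z\in x\to C(x)$ and $z\in x\to\mathrm{Setom}(z)$; * $(C(x)\wedge C(y)\wedge\forall z(z\in x\leftrightarrow z\in y))\to x=y$; * $\exists x\,(C(x)\wedge\forall z\in\mathrm{Setom}\,(z\in x\leftrightarrow\phi))$ for every $\mathcal{L}_{\mathsf{Class}}$-formula $\phi$ in which $x$ is not free (parameters allowed); * $\forall\vec y\in\mathrm{Setom}\,\exists x\in\mathrm{Setom}\,\forall z\in\mathrm{Setom}\,(z\in x\leftrightarrow\phi(z,\vec y))$ for every stratified $\mathcal{L}_{\mathsf{Class}}$-formula $\phi$ with only $z,\vec y$ free, all of whose quantifiers are bounded to $\mathrm{Setom}$; * $\forall x,y,x',y'\in\mathrm{Setom}\,(\langle x,y\rangle=\langle x',y'\rangle\leftrightarrow(x=x'\wedge y=y'))$, where $\langle x,y\rangle=\langle x',y'\rangle$ means $\exists w(\langle x,y\rangle=w\wedge\langle x',y'\rangle=w)$; and $(\langle x,y\rangle=z\wedge\langle x,y\rangle=z')\to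 z=z'$; * $S(x)\leftrightarrow(\mathrm{Setom}(x)\wedge C(x))$. $\mathrm{(I)ML}_{\mathsf{Class}}$ has in addition the axiom $\forall x\in\mathrm{Setom}\;S(x)$. **Semantics.** A *topos* is a category $\mathbf{E}$ with finite limits in which every object $A$ has a *power object*: an object $\mathbf{P}A$ with a mono $m:{\in_A}\rightarrowtail A\times\mathbf{P}A$ such that every mono $r:R\rightarrowtail A\times B$ is the pullback of $m$ along $\mathrm{id}_A\times\chi$ for a unique $\chi:B\to\mathbf{P}A$. A topos is a Heyting category. A structure in $\mathbf{E}$ consists of an object $N$ (the domain), a morphism $N^n\to N$ for each $n$-ary function symbol and a subobject of $N^n$ for each $n$-ary relation symbol. A formula $\phi$ in context $x_1,\dots,x_n$ is interpreted as a subobject of $N^n$: relation symbols and equality (the diagonal) by inverse images, propositional connectives by the Heyting algebra operations on subobjects, and $\exists,\forall$ by the left and right adjoints of inverse image along the projection that forgets the quantified variable. $\phi$ is *valid* if it is interpreted as all of $N^n$. A model of one of the intuitionistic theories $\mathrm{INF(U)}_{\mathsf{Set}}$, $\mathrm{IML(U)}_{\mathsf{Class}}$ in $\mathbf{E}$ is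 a structure in which all its axioms are valid; a model of the corresponding classical theory $\mathrm{NF(U)}_{\mathsf{Set}}$, $\mathrm{ML(U)}_{\mathsf{Class}}$ is the same, where moreover $\mathbf{E}$ is Boolean (all lattices of subobjects are Boolean algebras). **Theorem.** Let $\mathbf{E}$ be a topos. If there is a model in $\mathbf{E}$ of $\mathrm{INFU}_{\mathsf{Set}}$, $\mathrm{INF}_{\mathsf{Set}}$, $\mathrm{NFU}_{\mathsf{Set}}$ or $\mathrm{NF}_{\mathsf{Set}}$, then there is a model in $\mathbf{E}$ of $\mathrm{IMLU}_{\mathsf{Class}}$, $\mathrm{IML}_{\mathsf{Class}}$, $\mathrm{MLU}_{\mathsf{Class}}$ or $\mathrm{ML}_{\mathsf{Class}}$, respectively. More precisely, let $\mathcal{N}$ be a model of $\mathrm{INFU}_{\mathsf{Set}}$ in $\mathbf{E}$ with domain $N$, sethood mono $n_S:S^{\mathcal N}\rightarrowtail N$, pairing $n_P:N\times N\to N$ and membership mono $n_\varepsilon:\varepsilon^{\mathcal N}\rightarrowtail N\times N$, and let $m:{\in_N}\rightarrowtail N\times\mathbf{P}N$ be any power object of $N$. Then there is a unique $\chi_S:S^{\mathcal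 N}\to\mathbf{P}N$ such that $n_\varepsilon=(\mathrm{id}_N\times n_S)\circ n'_\varepsilon$ for some $n'_\varepsilon:\varepsilon^{\mathcal N}\to N\times S^{\mathcal N}$ that is a pullback of $m$ along $\mathrm{id}_N\times\chi_S$. This $\chi_S$ is monic, and $n_S$ and $\chi_S$ have a pushout. For every pushout, with coprojections $m_{\mathrm{Setom}}:N\to M$ and $m_C:\mathbf{P}N\to M$, both coprojections are monic, and the following structure $\mathcal{M}$ with domain $M$ is a model of $\mathrm{IMLU}_{\mathsf{Class}}$, and of $\mathrm{IML}_{\mathsf{Class}}$ if $\mathcal N$ is a model of $\mathrm{INF}_{\mathsf{Set}}$: $\mathrm{Setom}$, $C$ and $S$ are interpreted by the monos $m_{\mathrm{Setom}}$, $m_C$ and $m_{\mathrm{Setom}}\circ n_S$; membership by $(m_{\mathrm{Setom}}\times m_C)\circ m:{\in_N}\rightarrowtail M\times M$; and $\langle x,y\rangle=z$ by the mono $(m_{\mathrm{Setom}}\pi_1,\,m_{\mathrm{Setom}}\pi_2,\,m_{\mathrm{Setom}}n_P):N\times N\rightarrowtail M^3$. -/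

import Mathlib

open CategoryTheory CategoryTheory.Limits

universe w u

namespace NFTopos

section Categories

variable {C : Type u} [Category.{w} C]

/-- `m : mem ⟶ A ⨯ PA` exhibits `PA` as a power object of `A`: `m` is monic, and every mono
`r : R ⟶ A ⨯ B` is the pullback of `m` along `𝟙 A × χ` for a unique `χ : B ⟶ PA`. -/
structure IsPowerObject [HasFiniteLimits C] {A PA mem : C} (m : mem ⟶ A ⨯ PA) : Prop where
  mono : Mono m
  existsUnique_classifying : ∀ {B R : C} (r : R ⟶ A ⨯ B), Mono r →
    ∃! χ : B ⟶ PA, ∃ t : R ⟶ mem, IsPullback t r m (prod.map (𝟙 A) χ)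

variable (C) in
/-- A topos: a category with finite limits and power objects. -/
class IsTopos : Prop extends HasFiniteLimits C where
  exists_powerObject : ∀ A : C, ∃ (PA mem : C) (m : mem ⟶ A ⨯ PA), IsPowerObject m

/-- A cover: a morphism that factors through no proper subobject of its codomain. -/
def IsCover {X Y : C} (f : X ⟶ Y) : Prop :=
  ∀ {I : C} (m : I ⟶ Y) (g : X ⟶ I), Mono m → g ≫ m = f → IsIso m

variable (C) in
/-- Heyting categories. `(Subobject.pullback f).obj` is the inverse image `f^*`. -/
class HeytingCategory : Prop extends HasFiniteLimits C, HasImages C where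
  isCover_of_isPullback : ∀ {W X Y Z : C} {f' : W ⟶ Z} {g' : W ⟶ X} {f : X ⟶ Y} {g : Z ⟶ Y},
    IsPullback g' f' f g → IsCover f → IsCover f'
  exists_isBot : ∀ X : C, ∃ A : Subobject X, IsBot A
  exists_isLUB : ∀ {X : C} (A B : Subobject X), ∃ D, IsLUB {A, B} D
  pullback_isBot : ∀ {X Y : C} (f : X ⟶ Y) (A : Subobject Y),
    IsBot A → IsBot ((Subobject.pullback f).obj A)
  pullback_isLUB : ∀ {X Y : C} (f : X ⟶ Y) (A B D : Subobject Y), IsLUB {A, B} D →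
    IsLUB {(Subobject.pullback f).obj A, (Subobject.pullback f).obj B}
      ((Subobject.pullback f).obj D)
  exists_leftAdjoint : ∀ {X Y : C} (f : X ⟶ Y), ∃ l : Subobject X → Subobject Y,
    GaloisConnection l (Subobject.pullback f).obj
  exists_rightAdjoint : ∀ {X Y : C} (f : X ⟶ Y), ∃ r : Subobject X → Subobject Y,
    GaloisConnection (Subobject.pullback f).obj r

theorem factors_pullback [HasPullbacks C] {X Y T : C} (f : X ⟶ Y) (A : Subobject Y)
    (h : T ⟶ X) : ((Subobject.pullback f).obj A).Factors h ↔ A.Factors (h ≫ f) := by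
  have sq := Subobject.isPullback f A
  constructor
  · intro hh
    have e : h ≫ f =
        (((Subobject.pullback f).obj A).factorThru h hh ≫ Subobject.pullbackπ f A) ≫ A.arrow := by
      rw [Category.assoc, sq.w, ← Category.assoc, Subobject.factorThru_arrow]
    rw [e]
    exact Subobject.factors_comp_arrow _
  · intro hh
    have e : sq.lift (A.factorThru _ hh) h (by simp) ≫ ((Subobject.pullback f).obj A).arrow = h :=
      sq.lift_snd _ _ _
    rw [← e]
    exact Subobject.factors_comp_arrow _

theorem le_iff_factors {X : C} {A B : Subobject X} :
    A ≤ B ↔ ∀ {T : C} (h : T ⟶ X), A.Factors h → B.Factors h :=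
  ⟨fun h _ _ hA => Subobject.factors_of_le _ h hA,
    fun h => Subobject.le_of_factors (h _ (Subobject.factors_self A))⟩

noncomputable section HeytingOperations

variable [HeytingCategory C]

/-- The left adjoint `∃_f` of the inverse image `f^*`. -/
def existsAlong {X Y : C} (f : X ⟶ Y) : Subobject X → Subobject Y :=
  (HeytingCategory.exists_leftAdjoint f).choose

theorem existsAlong_gc {X Y : C} (f : X ⟶ Y) :
    GaloisConnection (existsAlong f) (Subobject.pullback f).obj :=
  (HeytingCategory.exists_leftAdjoint f).choose_spec

/-- The right adjoint `∀_f` of the inverse image `f^*`. -/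
def forallAlong {X Y : C} (f : X ⟶ Y) : Subobject X → Subobject Y :=
  (HeytingCategory.exists_rightAdjoint f).choose

theorem forallAlong_gc {X Y : C} (f : X ⟶ Y) :
    GaloisConnection (Subobject.pullback f).obj (forallAlong f) :=
  (HeytingCategory.exists_rightAdjoint f).choose_spec

/-- The least subobject. -/
def botSub (X : C) : Subobject X := (HeytingCategory.exists_isBot X).choose

theorem botSub_le {X : C} (A : Subobject X) : botSub X ≤ A :=
  (HeytingCategory.exists_isBot X).choose_spec A

/-- The join of two subobjects. -/
def supSub {X : C} (A B : Subobject X) : Subobject X := (HeytingCategory.exists_isLUB A B).choose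

theorem isLUB_supSub {X : C} (A B : Subobject X) : IsLUB {A, B} (supSub A B) :=
  (HeytingCategory.exists_isLUB A B).choose_spec

/-- The Heyting implication `A → B`, obtained as `∀_a (a^* B)` for the inclusion `a` of `A`. -/
def impSub {X : C} (A B : Subobject X) : Subobject X :=
  forallAlong A.arrow ((Subobject.pullback A.arrow).obj B)

theorem le_impSub_iff {X : C} (D A B : Subobject X) : D ≤ impSub A B ↔ D ⊓ A ≤ B := by
  rw [impSub, ← (forallAlong_gc A.arrow).le_iff_le]
  simp only [le_iff_factors, factors_pullback, Subobject.inf_factors]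
  constructor
  · rintro h T x ⟨hD, hA⟩
    have := h (A.factorThru x hA) (by simpa using hD)
    simpa using this
  · intro h T x hD
    exact h _ ⟨hD, Subobject.factors_comp_arrow _⟩

/-- In a Heyting category every poset of subobjects is a Heyting algebra. -/
instance {X : C} : HeytingAlgebra (Subobject X) :=
  { (inferInstance : SemilatticeInf (Subobject X)),
    (inferInstance : OrderTop (Subobject X)) with
    sup := supSub
    le_sup_left := fun A B => (isLUB_supSub A B).1 (by simp)
    le_sup_right := fun A B => (isLUB_supSub A B).1 (by simp)
    sup_le := fun A B D hA hB => (isLUB_supSub A B).2 (by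
      rintro _ (rfl | rfl) <;> assumption)
    bot := botSub X
    bot_le := botSub_le
    himp := impSub
    le_himp_iff := le_impSub_iff
    compl := fun A => impSub A (botSub X)
    himp_bot := fun _ => rfl }

end HeytingOperations

variable (C) in
/-- Boolean categories: Heyting categories whose posets of subobjects are Boolean algebras,
that is, complemented (they are already bounded distributive lattices). -/
class BooleanCategory : Prop extends HeytingCategory C where
  exists_isCompl : ∀ {X : C} (A : Subobject X), ∃ B : Subobject X, IsCompl A B

section ToposIsHeyting

attribute [local simp] prod.lift_fst prod.lift_snd prod.lift_fst_assoc prod.lift_snd_assoc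

variable [IsTopos C]

/-- Universal quantification along any morphism, with its generalised-element description. -/
theorem exists_forall {X Y : C} (f : X ⟶ Y) (A : Subobject X) :
    ∃ B : Subobject Y, ∀ {T : C} (h : T ⟶ Y), B.Factors h ↔
      ∀ {T' : C} (a : T' ⟶ T) (x : T' ⟶ X), a ≫ h = x ≫ f → A.Factors x := by
  obtain ⟨PX, mem, m, hm⟩ := IsTopos.exists_powerObject X
  have hmono := hm.mono
  -- the graph of `f`, and its restriction to `A`
  let r₁ : X ⟶ X ⨯ Y := prod.lift (𝟙 X) f
  let r₂ : (A : C) ⟶ X ⨯ Y := prod.lift A.arrow (A.arrow ≫ f)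
  have e₁ : r₁ ≫ prod.fst = 𝟙 X := prod.lift_fst _ _
  have e₁' : r₁ ≫ prod.snd = f := prod.lift_snd _ _
  have e₂ : r₂ ≫ prod.fst = A.arrow := prod.lift_fst _ _
  have e₂' : r₂ ≫ prod.snd = A.arrow ≫ f := prod.lift_snd _ _
  have m₁ : Mono r₁ := mono_of_mono_fac e₁
  have m₂ : Mono r₂ := mono_of_mono_fac e₂
  obtain ⟨χ₁, ⟨t₁, sq₁⟩, -⟩ := hm.existsUnique_classifying r₁ m₁
  obtain ⟨χ₂, ⟨t₂, sq₂⟩, -⟩ := hm.existsUnique_classifying r₂ m₂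
  have key₁ : ∀ {S : C} (x : S ⟶ X) (y : S ⟶ Y),
      (∃ q : S ⟶ mem, q ≫ m = prod.lift x (y ≫ χ₁)) ↔ x ≫ f = y := by
    intro S x y
    constructor
    · rintro ⟨q, hq⟩
      have w : q ≫ m = prod.lift x y ≫ prod.map (𝟙 X) χ₁ := by simp [hq]
      have l := sq₁.lift_snd q (prod.lift x y) w
      have l₁ := congrArg (· ≫ prod.fst) l
      have l₂ := congrArg (· ≫ prod.snd) l
      simp only [Category.assoc, e₁, e₁', prod.lift_fst, prod.lift_snd, Category.comp_id] at l₁ l₂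
      rw [← l₁, l₂]
    · rintro rfl
      refine ⟨x ≫ t₁, ?_⟩
      rw [Category.assoc, sq₁.w]
      apply Limits.prod.hom_ext <;> simp [r₁]
  have key₂ : ∀ {S : C} (x : S ⟶ X) (y : S ⟶ Y),
      (∃ q : S ⟶ mem, q ≫ m = prod.lift x (y ≫ χ₂)) ↔ (A.Factors x ∧ x ≫ f = y) := by
    intro S x y
    constructor
    · rintro ⟨q, hq⟩
      have w : q ≫ m = prod.lift x y ≫ prod.map (𝟙 X) χ₂ := by simp [hq]
      have l := sq₂.lift_snd q (prod.lift x y) w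
      have l₁ := congrArg (· ≫ prod.fst) l
      have l₂ := congrArg (· ≫ prod.snd) l
      simp only [Category.assoc, e₂, e₂', prod.lift_fst, prod.lift_snd] at l₁ l₂
      constructor
      · rw [← l₁]; exact Subobject.factors_comp_arrow _
      · rw [← l₂, ← Category.assoc]; exact congrArg (· ≫ f) l₁.symm
    · rintro ⟨hx, rfl⟩
      refine ⟨A.factorThru x hx ≫ t₂, ?_⟩
      rw [Category.assoc, sq₂.w]
      apply Limits.prod.hom_ext <;> simp [r₂]
  refine ⟨Subobject.mk (equalizer.ι χ₁ χ₂), fun {T} h => ?_⟩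
  have fac : (Subobject.mk (equalizer.ι χ₁ χ₂)).Factors h ↔ h ≫ χ₁ = h ≫ χ₂ := by
    rw [Subobject.mk_factors_iff]
    constructor
    · rintro ⟨g, hg⟩
      have H : ∀ (g : T ⟶ equalizer χ₁ χ₂), g ≫ equalizer.ι χ₁ χ₂ = h → h ≫ χ₁ = h ≫ χ₂ := by
        rintro g rfl
        rw [Category.assoc, Category.assoc, equalizer.condition]
      exact H g hg
    · intro e
      exact ⟨equalizer.lift h e, equalizer.lift_ι h e⟩
  rw [fac]
  constructor
  · intro e T' a x w
    have h₁ := (key₁ x (a ≫ h)).2 w.symm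
    rw [Category.assoc, e, ← Category.assoc] at h₁
    exact ((key₂ x (a ≫ h)).1 h₁).1
  · intro H
    -- both composites classify the same subobject of `X ⨯ T`
    let p := pullback.snd m (prod.map (𝟙 X) (h ≫ χ₁))
    have pb := IsPullback.of_hasPullback m (prod.map (𝟙 X) (h ≫ χ₁))
    have pm : Mono p := inferInstance
    obtain ⟨χ, -, huniq⟩ := hm.existsUnique_classifying p pm
    rw [huniq (h ≫ χ₁) ⟨_, pb⟩]
    symm
    apply huniq
    have iff : ∀ {S : C} (x : S ⟶ X) (y : S ⟶ T),
        (∃ q : S ⟶ mem, q ≫ m = prod.lift x (y ≫ h ≫ χ₁)) ↔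
        (∃ q : S ⟶ mem, q ≫ m = prod.lift x (y ≫ h ≫ χ₂)) := by
      intro S x y
      have h₁ := key₁ x (y ≫ h)
      have h₂ := key₂ x (y ≫ h)
      rw [Category.assoc] at h₁ h₂
      rw [h₁, h₂]
      exact ⟨fun w => ⟨H y x w.symm, w⟩, fun w => w.2⟩
    have up : ∀ {S : C} (z : S ⟶ X ⨯ T) (c : T ⟶ PX),
        z ≫ prod.map (𝟙 X) c = prod.lift (z ≫ prod.fst) ((z ≫ prod.snd) ≫ c) := by
      intro S z c
      apply Limits.prod.hom_ext <;> simp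
    obtain ⟨q, hq⟩ := (iff (p ≫ prod.fst) (p ≫ prod.snd)).1
      ⟨_, pb.w.trans (up _ _)⟩
    refine ⟨q, ⟨⟨hq.trans (up _ _).symm⟩, ⟨PullbackCone.IsLimit.mk _
      (fun s => pb.lift ((iff (s.snd ≫ prod.fst) (s.snd ≫ prod.snd)).2
        ⟨s.fst, s.condition.trans (up _ _)⟩).choose s.snd
        (((iff (s.snd ≫ prod.fst) (s.snd ≫ prod.snd)).2
        ⟨s.fst, s.condition.trans (up _ _)⟩).choose_spec.trans (up _ _).symm)) ?_ ?_ ?_⟩⟩⟩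
    · intro s
      rw [← cancel_mono m, Category.assoc, hq.trans (up _ _).symm, ← Category.assoc]
      refine Eq.trans ?_ s.condition.symm
      exact congrArg (· ≫ prod.map (𝟙 X) (h ≫ χ₂)) (pb.lift_snd _ _ _)
    · intro s
      exact pb.lift_snd _ _ _
    · intro s l _ hl
      rw [← cancel_mono p, hl]
      exact (pb.lift_snd _ _ _).symm

/-- A generic subobject: every subobject is an inverse image of it. -/
theorem exists_generic : ∃ (W : C) (U : Subobject W), ∀ {X : C} (A : Subobject X),
    ∃ c : X ⟶ W, ∀ {T : C} (h : T ⟶ X), A.Factors h ↔ U.Factors (h ≫ c) := by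
  obtain ⟨W, mem, m, hm⟩ := IsTopos.exists_powerObject (⊤_ C)
  have hmono := hm.mono
  refine ⟨W, (Subobject.pullback (prod.lift (terminal.from W) (𝟙 W))).obj (Subobject.mk m), ?_⟩
  intro X A
  let r : (A : C) ⟶ (⊤_ C) ⨯ X := prod.lift (terminal.from _) A.arrow
  have e : r ≫ prod.snd = A.arrow := prod.lift_snd _ _
  have mr : Mono r := mono_of_mono_fac e
  obtain ⟨χ, ⟨t, sq⟩, -⟩ := hm.existsUnique_classifying r mr
  refine ⟨χ, fun {T} h => ?_⟩
  rw [factors_pullback, Subobject.mk_factors_iff]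
  have w : (h ≫ χ) ≫ prod.lift (terminal.from W) (𝟙 W) =
      prod.lift (terminal.from T) h ≫ prod.map (𝟙 _) χ := by
    apply Limits.prod.hom_ext
    · exact Subsingleton.elim _ _
    · simp
  rw [w]
  constructor
  · intro hA
    refine ⟨A.factorThru h hA ≫ t, ?_⟩
    change (A.factorThru h hA ≫ t) ≫ m = _
    rw [Category.assoc, sq.w, ← Category.assoc]
    congr 1
    apply Limits.prod.hom_ext
    · exact Subsingleton.elim _ _
    · simp [r]
  · rintro ⟨q, hq⟩
    have hq' : q ≫ m = prod.lift (terminal.from T) h ≫ prod.map (𝟙 _) χ := hq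
    have l := congrArg (· ≫ prod.snd) (sq.lift_snd q _ hq')
    simp only [Category.assoc, e, prod.lift_snd] at l
    rw [← l]
    exact Subobject.factors_comp_arrow _

theorem exists_imp {X : C} (A B : Subobject X) : ∃ D : Subobject X, ∀ {T : C} (h : T ⟶ X),
    D.Factors h ↔ ∀ {T' : C} (a : T' ⟶ T), A.Factors (a ≫ h) → B.Factors (a ≫ h) := by
  obtain ⟨D, hD⟩ := exists_forall A.arrow ((Subobject.pullback A.arrow).obj B)
  refine ⟨D, fun {T} h => ?_⟩
  rw [hD]
  simp only [factors_pullback]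
  constructor
  · intro H T' a ha
    have := H a (A.factorThru _ ha) (by simp)
    simpa using this
  · intro H T' a x w
    rw [← w]
    apply H
    rw [w]
    exact Subobject.factors_comp_arrow _

/-- The internal intersection of a family `D` of subobjects of `Y`: `y` belongs to it when
`w` holds for every truth value `w` with `(y, w) ∈ D`. -/
theorem exists_inter {W : C} (U : Subobject W) {Y : C} (D : Subobject (Y ⨯ W)) :
    ∃ B : Subobject Y, ∀ {T : C} (h : T ⟶ Y), B.Factors h ↔
      ∀ {T' : C} (a : T' ⟶ T) (w : T' ⟶ W), D.Factors (prod.lift (a ≫ h) w) → U.Factors w := by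
  obtain ⟨I, hI⟩ := exists_imp D ((Subobject.pullback prod.snd).obj U)
  obtain ⟨B, hB⟩ := exists_forall (prod.fst : Y ⨯ W ⟶ Y) I
  refine ⟨B, fun {T} h => ?_⟩
  rw [hB]
  simp only [hI, factors_pullback]
  constructor
  · intro H T' a w hw
    have := H a (prod.lift (a ≫ h) w) (by simp) (𝟙 _) (by simpa using hw)
    simpa using this
  · intro H T' a x e T'' b hb
    have e' : b ≫ x = prod.lift ((b ≫ a) ≫ h) ((b ≫ x) ≫ prod.snd) := by
      apply Limits.prod.hom_ext <;> simp [e]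
    rw [e'] at hb
    exact H (b ≫ a) _ hb

theorem exists_rightAdj {X Y : C} (f : X ⟶ Y) : ∃ r : Subobject X → Subobject Y,
    GaloisConnection (Subobject.pullback f).obj r := by
  choose r hr using fun A => exists_forall f A
  refine ⟨r, fun B A => ?_⟩
  simp only [le_iff_factors, factors_pullback]
  constructor
  · intro H T h hB
    rw [hr]
    intro T' a x w
    apply H
    rw [← w]
    exact Subobject.factors_of_factors_right a hB
  · intro H T x hB
    exact (hr A (x ≫ f)).1 (H _ hB) (𝟙 _) x (by simp)

theorem exists_leftAdj {X Y : C} (f : X ⟶ Y) : ∃ l : Subobject X → Subobject Y,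
    GaloisConnection l (Subobject.pullback f).obj := by
  obtain ⟨W, U, hU⟩ := exists_generic (C := C)
  have : ∀ A : Subobject X, ∃ L : Subobject Y, ∀ B,
      L ≤ B ↔ A ≤ (Subobject.pullback f).obj B := by
    intro A
    obtain ⟨I, hI⟩ := exists_imp ((Subobject.pullback (prod.fst : X ⨯ W ⟶ X)).obj A)
      ((Subobject.pullback prod.snd).obj U)
    obtain ⟨D, hD⟩ := exists_forall (prod.map f (𝟙 W)) I
    obtain ⟨L, hL⟩ := exists_inter U D
    refine ⟨L, fun B => ⟨fun H => ?_, fun H => ?_⟩⟩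
    · refine le_trans (le_iff_factors.2 fun {T} x hx => ?_) ((Subobject.pullback f).monotone H)
      rw [factors_pullback, hL]
      intro T' a w hw
      have h₁ := (hD _).1 hw (𝟙 _) (prod.lift (a ≫ x) w) (by simp)
      have h₂ := (hI _).1 h₁ (𝟙 _)
      simp only [factors_pullback, Category.id_comp, prod.lift_fst, prod.lift_snd] at h₂
      exact h₂ (Subobject.factors_of_factors_right a hx)
    · obtain ⟨c, hc⟩ := hU B
      refine le_iff_factors.2 fun {T} y hy => ?_
      rw [hc]
      refine (hL y).1 hy (𝟙 _) (y ≫ c) ((hD _).2 ?_)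
      intro T' a x w
      rw [hI]
      intro T'' b hb
      have w₁ := congrArg (· ≫ prod.fst) w
      have w₂ := congrArg (· ≫ prod.snd) w
      simp only [Category.assoc, Category.id_comp, prod.lift_fst, prod.lift_snd, prod.map_fst,
        prod.map_snd, Category.comp_id] at w₁ w₂
      rw [factors_pullback] at hb ⊢
      have h₁ := le_iff_factors.1 H _ hb
      rw [factors_pullback, hc] at h₁
      have e : ((b ≫ x) ≫ prod.fst) ≫ f = b ≫ a ≫ y := by
        rw [w₁]; simp only [Category.assoc]
      rw [e] at h₁
      rw [Category.assoc, ← w₂]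
      simpa only [Category.assoc] using h₁
  choose l hl using this
  exact ⟨l, fun A B => hl A B⟩

theorem topos_exists_isBot (X : C) : ∃ A : Subobject X, IsBot A := by
  obtain ⟨W, U, hU⟩ := exists_generic (C := C)
  obtain ⟨L, hL⟩ := exists_inter U (⊤ : Subobject (X ⨯ W))
  refine ⟨L, fun B => le_iff_factors.2 fun {T} x hx => ?_⟩
  obtain ⟨c, hc⟩ := hU B
  exact (hc x).2 ((hL x).1 hx (𝟙 _) (x ≫ c) (Subobject.top_factors _))

theorem topos_exists_isLUB {X : C} (A B : Subobject X) : ∃ D, IsLUB {A, B} D := by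
  obtain ⟨W, U, hU⟩ := exists_generic (C := C)
  obtain ⟨I, hI⟩ := exists_imp ((Subobject.pullback (prod.fst : X ⨯ W ⟶ X)).obj A)
    ((Subobject.pullback prod.snd).obj U)
  obtain ⟨J, hJ⟩ := exists_imp ((Subobject.pullback (prod.fst : X ⨯ W ⟶ X)).obj B)
    ((Subobject.pullback prod.snd).obj U)
  obtain ⟨L, hL⟩ := exists_inter U (I ⊓ J)
  simp only [Subobject.inf_factors, hI, hJ, factors_pullback, prod.comp_lift, prod.lift_fst,
    prod.lift_snd] at hL
  refine ⟨L, ?_, fun D hD => le_iff_factors.2 fun {T} x hx => ?_⟩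
  · rintro _ (rfl | rfl) <;> refine le_iff_factors.2 fun {T} x hx => (hL x).2 ?_ <;>
      intro T' a w hw
    · simpa using hw.1 (𝟙 _) (Subobject.factors_of_factors_right _
        (Subobject.factors_of_factors_right _ hx))
    · simpa using hw.2 (𝟙 _) (Subobject.factors_of_factors_right _
        (Subobject.factors_of_factors_right _ hx))
  · obtain ⟨c, hc⟩ := hU D
    have hA : A ≤ D := hD (by simp)
    have hB : B ≤ D := hD (by simp)
    rw [hc]
    refine (hL x).1 hx (𝟙 _) (x ≫ c) ⟨fun {T'} a ha => ?_, fun {T'} a ha => ?_⟩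
    · rw [← Category.assoc, ← hc]
      simpa using Subobject.factors_of_le _ hA ha
    · rw [← Category.assoc, ← hc]
      simpa using Subobject.factors_of_le _ hB ha

/-- Every topos is a Heyting category. -/
instance : HeytingCategory C where
  has_image {X Y} f := by
    obtain ⟨l, hl⟩ := exists_leftAdj f
    have hf : ∀ B : Subobject Y, l ⊤ ≤ B ↔ B.Factors f := by
      intro B
      rw [hl.le_iff_le]
      constructor
      · intro h
        have := Subobject.factors_of_le (𝟙 X) h (Subobject.top_factors _)
        rw [factors_pullback] at this
        simpa using this
      · intro h
        refine le_iff_factors.2 fun {T} x _ => ?_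
        rw [factors_pullback]
        exact Subobject.factors_of_factors_right _ h
    have h₀ : (l ⊤).Factors f := (hf _).1 le_rfl
    refine HasImage.mk ⟨⟨(l ⊤ : Subobject Y), (l ⊤).arrow, (l ⊤).factorThru f h₀, by simp⟩, ?_⟩
    have h₁ : ∀ F : MonoFactorisation f, l ⊤ ≤ Subobject.mk F.m := fun F => by
      rw [hf, Subobject.mk_factors_iff]
      exact ⟨F.e, F.fac⟩
    exact ⟨fun F => Subobject.ofLEMk (l ⊤) F.m (h₁ F), fun F => by simp⟩
  isCover_of_isPullback {W X Y Z f' g' f g} sq hf := by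
    intro I m k hm hk
    obtain ⟨B, hB⟩ := exists_forall g (Subobject.mk m)
    have hfB : B.Factors f := by
      rw [hB]
      intro T a x w
      rw [Subobject.mk_factors_iff]
      refine ⟨sq.lift a x w ≫ k, ?_⟩
      change (sq.lift a x w ≫ k) ≫ m = x
      rw [Category.assoc, hk]
      exact sq.lift_snd _ _ _
    have hi : IsIso B.arrow := hf B.arrow (B.factorThru f hfB) inferInstance (by simp)
    have hg : B.Factors g := by
      rw [Subobject.isIso_arrow_iff_eq_top] at hi
      rw [hi]
      exact Subobject.top_factors _
    have := (hB g).1 hg (𝟙 _) (𝟙 _) rfl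
    rw [Subobject.isIso_iff_mk_eq_top]
    refine top_le_iff.1 (le_iff_factors.2 fun {T} x _ => ?_)
    simpa using Subobject.factors_of_factors_right x this
  exists_isBot := topos_exists_isBot
  exists_isLUB := topos_exists_isLUB
  pullback_isBot f A hA := by
    obtain ⟨r, hr⟩ := exists_rightAdj f
    intro B
    exact hr.le_iff_le.2 (hA _)
  pullback_isLUB f A B D h := by
    obtain ⟨r, hr⟩ := exists_rightAdj f
    have := hr.isLUB_l_image h
    rwa [Set.image_pair] at this
  exists_leftAdjoint := exists_leftAdj
  exists_rightAdjoint := exists_rightAdj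

end ToposIsHeyting

end Categories

section Logic

/-- First-order formulas over `L` whose free variables are among `x₀, …, xₙ₋₁`, with all
connectives of intuitionistic logic as primitives. A quantifier binds the last variable of the
context of its body. -/
inductive Formula (L : FirstOrder.Language.{0, 0}) : ℕ → Type
  | falsum {n : ℕ} : Formula L n
  | equal {n : ℕ} (t u : L.Term (Fin n)) : Formula L n
  | rel {n l : ℕ} (R : L.Relations l) (ts : Fin l → L.Term (Fin n)) : Formula L n
  | and {n : ℕ} (φ ψ : Formula L n) : Formula L n
  | or {n : ℕ} (φ ψ : Formula L n) : Formula L n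
  | imp {n : ℕ} (φ ψ : Formula L n) : Formula L n
  | all {n : ℕ} (φ : Formula L (n + 1)) : Formula L n
  | ex {n : ℕ} (φ : Formula L (n + 1)) : Formula L n

variable {L : FirstOrder.Language.{0, 0}}

/-- The variable `xᵢ`. -/
abbrev var {n : ℕ} (i : Fin n) : L.Term (Fin n) := FirstOrder.Language.Term.var i

namespace Formula

def iff {n : ℕ} (φ ψ : Formula L n) : Formula L n := and (imp φ ψ) (imp ψ φ)

/-- Finite conjunctions. -/
def conj {n : ℕ} : {k : ℕ} → (Fin k → Formula L n) → Formula L n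
  | 0, _ => imp falsum falsum
  | _ + 1, φ => and (conj fun i => φ i.castSucc) (φ (Fin.last _))

/-- Renaming of free variables. -/
def rename : {n m : ℕ} → (Fin n → Fin m) → Formula L n → Formula L m
  | _, _, _, falsum => falsum
  | _, _, r, equal t u => equal (t.relabel r) (u.relabel r)
  | _, _, r, rel R ts => rel R fun i => (ts i).relabel r
  | _, _, r, and φ ψ => and (φ.rename r) (ψ.rename r)
  | _, _, r, or φ ψ => or (φ.rename r) (ψ.rename r)
  | _, _, r, imp φ ψ => imp (φ.rename r) (ψ.rename r)
  | _, m, r, all φ => all (φ.rename (Fin.snoc (fun i => (r i).castSucc) (Fin.last m)))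
  | _, m, r, ex φ => ex (φ.rename (Fin.snoc (fun i => (r i).castSucc) (Fin.last m)))

/-- For `φ(y₀, …, yₙ₋₁, z)`, the formula `φ(y₀, …, yₙ₋₁, z)` in the context
`(y₀, …, yₙ₋₁, x, z)`, where `x` is fresh. -/
def insertFresh {n : ℕ} (φ : Formula L (n + 1)) : Formula L (n + 2) :=
  φ.rename (Fin.last n).castSucc.succAbove

end Formula

/-- `HasType s t k`: under the assignment `s` of types to variables the term `t` has type `k`;
the arguments of a function symbol have the same type as the value. -/
def HasType {n : ℕ} (s : Fin n → ℕ) : L.Term (Fin n) → ℕ → Prop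
  | .var i, k => s i = k
  | .func _ ts, k => ∀ i, HasType s (ts i) k

/-- `s` extends to a stratification of the formula: every term gets a type, both sides of an
equation get the same type, and the types of the arguments of a relation symbol `R` satisfy the
condition `c R`. Each bound variable is given a type of its own. -/
def StratifiedBy (c : ∀ {l : ℕ}, L.Relations l → (Fin l → ℕ) → Prop) :
    {n : ℕ} → (Fin n → ℕ) → Formula L n → Prop
  | _, _, .falsum => True
  | _, s, .equal t u => ∃ k, HasType s t k ∧ HasType s u k
  | _, s, .rel R ts => ∃ k, (∀ i, HasType s (ts i) (k i)) ∧ c R k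
  | _, s, .and φ ψ => StratifiedBy c s φ ∧ StratifiedBy c s ψ
  | _, s, .or φ ψ => StratifiedBy c s φ ∧ StratifiedBy c s ψ
  | _, s, .imp φ ψ => StratifiedBy c s φ ∧ StratifiedBy c s ψ
  | _, s, .all φ => ∃ k, StratifiedBy c (Fin.snoc (α := fun _ => ℕ) s k) φ
  | _, s, .ex φ => ∃ k, StratifiedBy c (Fin.snoc (α := fun _ => ℕ) s k) φ

/-- A theory, as a collection of formulas in context. An open formula stands for its universal
closure. -/
abbrev Theory (L : FirstOrder.Language.{0, 0}) := ∀ ⦃n : ℕ⦄, Formula L n → Prop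

end Logic

section SetTheory

inductive SetFuncSymb : ℕ → Type
  /-- the ordered pair `⟨-, -⟩` -/
  | pair : SetFuncSymb 2

inductive SetRelSymb : ℕ → Type
  /-- membership -/
  | mem : SetRelSymb 2
  /-- the sethood predicate `S` -/
  | isSet : SetRelSymb 1

/-- The language `{∈, S, ⟨-, -⟩}` of set theory. -/
abbrev LSet : FirstOrder.Language.{0, 0} := ⟨SetFuncSymb, SetRelSymb⟩

namespace LSet

variable {n : ℕ}

def mem (t u : LSet.Term (Fin n)) : Formula LSet n := .rel SetRelSymb.mem ![t, u]

def isSet (t : LSet.Term (Fin n)) : Formula LSet n := .rel SetRelSymb.isSet ![t]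

def pair (t u : LSet.Term (Fin n)) : LSet.Term (Fin n) := .func SetFuncSymb.pair ![t, u]

/-- In `t ∈ u` the type of `u` is one higher than the type of `t`. -/
def typing : {l : ℕ} → SetRelSymb l → (Fin l → ℕ) → Prop
  | _, .mem, k => k 0 + 1 = k 1
  | _, .isSet, _ => True

/-- Stratified formulas of the language of set theory. -/
def Stratified (φ : Formula LSet n) : Prop := ∃ s, StratifiedBy (L := LSet) typing s φ

/-- Extensionality: `S(x) ∧ S(y) ∧ ∀ z (z ∈ x ↔ z ∈ y) → x = y`. -/
def extensionality : Formula LSet 2 :=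
  .imp (.and (isSet (var 0)) (.and (isSet (var 1)) (.all (.iff (mem (var 2) (var 0)) (mem (var 2) (var 1))))))
    (.equal (var 0) (var 1))

/-- Comprehension for `φ(y₀, …, yₙ₋₁, z)`: `∃ x (S(x) ∧ ∀ z (z ∈ x ↔ φ))`. -/
def comprehension (φ : Formula LSet (n + 1)) : Formula LSet n :=
  .ex (.and (isSet (var (Fin.last n)))
    (.all (.iff (mem (var (Fin.last (n + 1))) (var (Fin.last n).castSucc)) φ.insertFresh)))

/-- Ordered pair: `⟨x, y⟩ = ⟨x', y'⟩ → x = x' ∧ y = y'`. -/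
def orderedPair : Formula LSet 4 :=
  .imp (.equal (pair (var 0) (var 1)) (pair (var 2) (var 3)))
    (.and (.equal (var 0) (var 2)) (.equal (var 1) (var 3)))

/-- Sethood: `z ∈ x → S(x)`. -/
def sethood : Formula LSet 2 := .imp (mem (var 0) (var 1)) (isSet (var 1))

/-- Everything is a set: `S(x)`. -/
def allSets : Formula LSet 1 := isSet (var 0)

end LSet

/-- The axioms of `(I)NFU`. -/
inductive NFU : ∀ ⦃n : ℕ⦄, Formula LSet n → Prop
  | extensionality : NFU LSet.extensionality
  | comprehension {n : ℕ} (φ : Formula LSet (n + 1)) :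
      LSet.Stratified φ → NFU (LSet.comprehension φ)
  | orderedPair : NFU LSet.orderedPair
  | sethood : NFU LSet.sethood

/-- The axioms of `(I)NF`: those of `(I)NFU`, and that everything is a set. -/
inductive NF : ∀ ⦃n : ℕ⦄, Formula LSet n → Prop
  | ofNFU {n : ℕ} (φ : Formula LSet n) : NFU φ → NF φ
  | allSets : NF LSet.allSets

end SetTheory

section ClassTheory

inductive ClassRelSymb : ℕ → Type
  /-- membership -/
  | mem : ClassRelSymb 2
  /-- the sethood predicate `S` -/
  | isSet : ClassRelSymb 1
  /-- the classhood predicate `C` -/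
  | isClass : ClassRelSymb 1
  /-- the predicate `Setom` of sets and atoms -/
  | isSetom : ClassRelSymb 1
  /-- the graph `⟨x, y⟩ = z` of the partial ordered pair function -/
  | pair : ClassRelSymb 3

/-- The language of class theory. -/
abbrev LClass : FirstOrder.Language.{0, 0} := ⟨fun _ => Empty, ClassRelSymb⟩

namespace LClass

variable {n : ℕ}

def mem (t u : LClass.Term (Fin n)) : Formula LClass n := .rel ClassRelSymb.mem ![t, u]

def isSet (t : LClass.Term (Fin n)) : Formula LClass n := .rel ClassRelSymb.isSet ![t]

def isClass (t : LClass.Term (Fin n)) : Formula LClass n := .rel ClassRelSymb.isClass ![t]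

def isSetom (t : LClass.Term (Fin n)) : Formula LClass n := .rel ClassRelSymb.isSetom ![t]

/-- `⟨t, u⟩ = w`. -/
def pair (t u w : LClass.Term (Fin n)) : Formula LClass n := .rel ClassRelSymb.pair ![t, u, w]

/-- In `t ∈ u` the type of `u` is one higher than the type of `t`; in `⟨t, u⟩ = w` all types
agree. -/
def typing : {l : ℕ} → ClassRelSymb l → (Fin l → ℕ) → Prop
  | _, .mem, k => k 0 + 1 = k 1
  | _, .isSet, _ => True
  | _, .isClass, _ => True
  | _, .isSetom, _ => True
  | _, .pair, k => k 0 = k 1 ∧ k 1 = k 2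

/-- Stratified formulas of the language of class theory. -/
def Stratified (φ : Formula LClass n) : Prop := ∃ s, StratifiedBy (L := LClass) typing s φ

/-- The formula obtained by bounding all quantifiers to `Setom`. -/
def bound : {n : ℕ} → Formula LClass n → Formula LClass n
  | _, .falsum => .falsum
  | _, .equal t u => .equal t u
  | _, .rel R ts => .rel R ts
  | _, .and φ ψ => .and (bound φ) (bound ψ)
  | _, .or φ ψ => .or (bound φ) (bound ψ)
  | _, .imp φ ψ => .imp (bound φ) (bound ψ)
  | n, .all φ => .all (.imp (isSetom (var (Fin.last n))) (bound φ))
  | n, .ex φ => .ex (.and (isSetom (var (Fin.last n))) (bound φ))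

/-- Classhood: `z ∈ x → C(x)`. -/
def classhood : Formula LClass 2 := .imp (mem (var 0) (var 1)) (isClass (var 1))

/-- Setomhood: `z ∈ x → Setom(z)`. -/
def setomhood : Formula LClass 2 := .imp (mem (var 0) (var 1)) (isSetom (var 0))

/-- Extensionality for classes: `C(x) ∧ C(y) ∧ ∀ z (z ∈ x ↔ z ∈ y) → x = y`. -/
def extensionality : Formula LClass 2 :=
  .imp (.and (isClass (var 0))
      (.and (isClass (var 1)) (.all (.iff (mem (var 2) (var 0)) (mem (var 2) (var 1))))))
    (.equal (var 0) (var 1))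

/-- Class comprehension for `φ(y₀, …, yₙ₋₁, z)`:
`∃ x (C(x) ∧ ∀ z ∈ Setom (z ∈ x ↔ φ))`. -/
def classComprehension (φ : Formula LClass (n + 1)) : Formula LClass n :=
  .ex (.and (isClass (var (Fin.last n)))
    (.all (.imp (isSetom (var (Fin.last (n + 1))))
      (.iff (mem (var (Fin.last (n + 1))) (var (Fin.last n).castSucc)) φ.insertFresh))))

/-- Set comprehension for `φ(y₀, …, yₙ₋₁, z)`:
`∀ y₀, …, yₙ₋₁ ∈ Setom ∃ x ∈ Setom ∀ z ∈ Setom (z ∈ x ↔ φ)`. -/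
def setComprehension (φ : Formula LClass (n + 1)) : Formula LClass n :=
  .imp (.conj fun i : Fin n => isSetom (var i))
    (.ex (.and (isSetom (var (Fin.last n)))
      (.all (.imp (isSetom (var (Fin.last (n + 1))))
        (.iff (mem (var (Fin.last (n + 1))) (var (Fin.last n).castSucc)) φ.insertFresh)))))

/-- Ordered pair: `∀ x, y, x', y' ∈ Setom (⟨x, y⟩ = ⟨x', y'⟩ ↔ x = x' ∧ y = y')`, where
`⟨x, y⟩ = ⟨x', y'⟩` means that both pairs are defined and have the same value. -/
def orderedPair : Formula LClass 4 :=
  .imp (.conj fun i : Fin 4 => isSetom (var i))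
    (.iff (.ex (.and (pair (var 0) (var 1) (var 4)) (pair (var 2) (var 3) (var 4))))
      (.and (.equal (var 0) (var 2)) (.equal (var 1) (var 3))))

/-- The ordered pair is a partial function: `⟨x, y⟩ = z ∧ ⟨x, y⟩ = z' → z = z'`. -/
def pairFunctional : Formula LClass 4 :=
  .imp (.and (pair (var 0) (var 1) (var 2)) (pair (var 0) (var 1) (var 3))) (.equal (var 2) (var 3))

/-- Sets are the setoms that are classes: `S(x) ↔ Setom(x) ∧ C(x)`. -/
def setIffSetomClass : Formula LClass 1 :=
  .iff (isSet (var 0)) (.and (isSetom (var 0)) (isClass (var 0)))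

/-- `∀ x ∈ Setom S(x)`. -/
def allSets : Formula LClass 1 := .imp (isSetom (var 0)) (isSet (var 0))

end LClass

/-- The axioms of (impredicative) `(I)MLU`. -/
inductive MLU : ∀ ⦃n : ℕ⦄, Formula LClass n → Prop
  | classhood : MLU LClass.classhood
  | setomhood : MLU LClass.setomhood
  | extensionality : MLU LClass.extensionality
  | classComprehension {n : ℕ} (φ : Formula LClass (n + 1)) : MLU (LClass.classComprehension φ)
  | setComprehension {n : ℕ} (φ : Formula LClass (n + 1)) :
      LClass.Stratified φ → MLU (LClass.setComprehension (LClass.bound φ))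
  | orderedPair : MLU LClass.orderedPair
  | pairFunctional : MLU LClass.pairFunctional
  | setIffSetomClass : MLU LClass.setIffSetomClass

/-- The axioms of `(I)ML`: those of `(I)MLU`, and that every setom is a set. -/
inductive ML : ∀ ⦃n : ℕ⦄, Formula LClass n → Prop
  | ofMLU {n : ℕ} (φ : Formula LClass n) : MLU φ → ML φ
  | allSets : ML LClass.allSets

end ClassTheory

noncomputable section Semantics

/-- A structure for the one-sorted language `L` in the category `C`. -/
structure CatStructure (C : Type u) [Category.{w} C] [HasFiniteLimits C]
    (L : FirstOrder.Language.{0, 0}) where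
  carrier : C
  func : ∀ {n : ℕ}, L.Functions n → ((∏ᶜ fun _ : Fin n => carrier) ⟶ carrier)
  rel : ∀ {n : ℕ}, L.Relations n → Subobject (∏ᶜ fun _ : Fin n => carrier)

namespace CatStructure

variable {C : Type u} [Category.{w} C] {L : FirstOrder.Language.{0, 0}}

section Interpretation

variable [HeytingCategory C] (M : CatStructure C L)

/-- The `n`-th power of the carrier. -/
abbrev pow (n : ℕ) : C := ∏ᶜ fun _ : Fin n => M.carrier

/-- The interpretation of a term in context. -/
def term {n : ℕ} : L.Term (Fin n) → (M.pow n ⟶ M.carrier)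
  | .var i => Pi.π _ i
  | .func f ts => Pi.lift (fun i => term (ts i)) ≫ M.func f

/-- The projection that forgets the last variable of a context. -/
def forget (n : ℕ) : M.pow (n + 1) ⟶ M.pow n :=
  Pi.lift fun i : Fin n => Pi.π (fun _ : Fin (n + 1) => M.carrier) i.castSucc

/-- The interpretation of a formula in context. -/
def interp : {n : ℕ} → Formula L n → Subobject (M.pow n)
  | _, .falsum => ⊥
  | _, .equal t u =>
      (Subobject.pullback (prod.lift (M.term t) (M.term u))).obj (Subobject.mk (diag M.carrier))
  | _, .rel R ts => (Subobject.pullback (Pi.lift fun i => M.term (ts i))).obj (M.rel R)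
  | _, .and φ ψ => interp φ ⊓ interp ψ
  | _, .or φ ψ => interp φ ⊔ interp ψ
  | _, .imp φ ψ => interp φ ⇨ interp ψ
  | n, .all φ => forallAlong (M.forget n) (interp φ)
  | n, .ex φ => existsAlong (M.forget n) (interp φ)

/-- `M` is a model of the theory `T` in intuitionistic logic: all members of `T` are valid. -/
def Models (T : Theory L) : Prop := ∀ ⦃n : ℕ⦄ (φ : Formula L n), T φ → M.interp φ = ⊤

/-- `M` is a model of the theory `T` in classical logic: the category is Boolean as well. -/
def ModelsClassically (T : Theory L) : Prop := BooleanCategory C ∧ M.Models T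

end Interpretation

section Construction

variable [HasFiniteLimits C] (N : CatStructure C LSet)

/-- The object `S^N` of sets. -/
abbrev sets : C := (N.rel SetRelSymb.isSet : C)

/-- The mono `S^N ⟶ N`. -/
def setsIncl : N.sets ⟶ N.carrier := (N.rel SetRelSymb.isSet).arrow ≫ Pi.π _ 0

/-- The membership relation as a mono into `N ⨯ N`. -/
def memIncl : (N.rel SetRelSymb.mem : C) ⟶ N.carrier ⨯ N.carrier :=
  (N.rel SetRelSymb.mem).arrow ≫ prod.lift (Pi.π _ 0) (Pi.π _ 1)

/-- The ordered pair as a morphism `N ⨯ N ⟶ N`. -/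
def pairing : N.carrier ⨯ N.carrier ⟶ N.carrier :=
  Pi.lift (fun i => (![prod.fst, prod.snd] : Fin 2 → (N.carrier ⨯ N.carrier ⟶ N.carrier)) i) ≫
    N.func SetFuncSymb.pair

/-- `χ : S^N ⟶ PN` classifies the membership relation of `N`: the membership relation factors
through a mono `ε' : ε^N ⟶ N ⨯ S^N`, which is the pullback of `m : ∈_N ⟶ N ⨯ PN` along
`𝟙 N × χ`. -/
def ClassifiesMembership {PN mem : C} (m : mem ⟶ N.carrier ⨯ PN) (χ : N.sets ⟶ PN) : Prop :=
  ∃ (ε' : (N.rel SetRelSymb.mem : C) ⟶ N.carrier ⨯ N.sets) (t : (N.rel SetRelSymb.mem : C) ⟶ mem),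
    ε' ≫ prod.map (𝟙 N.carrier) N.setsIncl = N.memIncl ∧
    IsPullback t ε' m (prod.map (𝟙 N.carrier) χ)

variable {X Y : C}

instance mono_piLift_one (f : X ⟶ Y) [Mono f] : Mono (Pi.lift fun _ : Fin 1 => f) :=
  mono_of_mono_fac (Pi.lift_π (fun _ : Fin 1 => f) 0)

theorem mono_piLift {n : ℕ} (f : Fin n → (X ⟶ Y))
    (h : ∀ {T : C} (a b : T ⟶ X), (∀ i, a ≫ f i = b ≫ f i) → a = b) : Mono (Pi.lift f) where
  right_cancellation a b e := h a b fun i => by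
    have := congrArg (· ≫ Pi.π (fun _ : Fin n => Y) i) e
    simpa only [Category.assoc, Pi.lift_π] using this

instance mono_setsIncl : Mono N.setsIncl where
  right_cancellation a b e := by
    rw [← cancel_mono (N.rel SetRelSymb.isSet).arrow]
    refine Pi.hom_ext _ _ fun i => ?_
    obtain rfl : i = 0 := Subsingleton.elim _ _
    simpa [setsIncl] using e

instance mono_memClass {N PN mem M : C} (m : mem ⟶ N ⨯ PN) (mSetom : N ⟶ M) (mC : PN ⟶ M)
    [Mono m] [Mono mSetom] [Mono mC] :
    Mono (Pi.lift ![m ≫ prod.fst ≫ mSetom, m ≫ prod.snd ≫ mC]) :=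
  mono_piLift _ fun a b e => by
    have e₀ := e 0
    have e₁ := e 1
    simp only [Matrix.cons_val_zero, Matrix.cons_val_one, ← Category.assoc, cancel_mono] at e₀ e₁
    rw [← cancel_mono m]
    apply Limits.prod.hom_ext
    · exact e₀
    · exact e₁

instance mono_pairClass {N M : C} (p : N ⨯ N ⟶ N) (mSetom : N ⟶ M) [Mono mSetom] :
    Mono (Pi.lift ![prod.fst ≫ mSetom, prod.snd ≫ mSetom, p ≫ mSetom]) :=
  mono_piLift _ fun a b e => by
    have e₀ := e 0
    have e₁ := e 1
    simp only [Matrix.cons_val_zero, Matrix.cons_val_one, ← Category.assoc, cancel_mono] at e₀ e₁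
    apply Limits.prod.hom_ext
    · exact e₀
    · exact e₁

/-- The structure for the language of class theory with carrier `M`, given monos
`mSetom : N ⟶ M` and `mC : PN ⟶ M`: these interpret `Setom` and `C`; sethood and the graph of the
ordered pair are those of `N`, embedded along `mSetom`; and membership is the composite of
`m : ∈_N ⟶ N ⨯ PN` with `mSetom × mC`. -/
def classStructure {PN mem M : C} (m : mem ⟶ N.carrier ⨯ PN) (mSetom : N.carrier ⟶ M)
    (mC : PN ⟶ M) [Mono m] [Mono mSetom] [Mono mC] : CatStructure C LClass where
  carrier := M
  func f := f.elim
  rel R := match R with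
    | ClassRelSymb.mem => Subobject.mk (Pi.lift ![m ≫ prod.fst ≫ mSetom, m ≫ prod.snd ≫ mC])
    | ClassRelSymb.isSet => Subobject.mk (Pi.lift fun _ : Fin 1 => N.setsIncl ≫ mSetom)
    | ClassRelSymb.isClass => Subobject.mk (Pi.lift fun _ : Fin 1 => mC)
    | ClassRelSymb.isSetom => Subobject.mk (Pi.lift fun _ : Fin 1 => mSetom)
    | ClassRelSymb.pair => Subobject.mk
        (Pi.lift ![prod.fst ≫ mSetom, prod.snd ≫ mSetom, N.pairing ≫ mSetom])

end Construction

end CatStructure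

end Semantics

end NFTopos

open NFTopos

/-!
Everything is reduced to Kripke–Joyal semantics: a formula `φ` in context holds of a tuple `h` of
generalised elements `T ⟶ M` (`CatStructure.Forces`) when `h` factors through the interpretation of
`φ`, and each connective then has its usual forcing clause. The clause for `∃` asks for a witness
on a cover of `T`, the one for `∨` is stated in its second-order form.

*The pushout.* The universal property of a pushout has to be established by hand, since a topos is
only assumed to have finite limits and power objects. Monos `a : S ⟶ N` and `b : S ⟶ P` embed `N`
and `P` into `PN ⨯ PP` with intersection `S` (`exists_amalgam`). In the union of the two images, a
compatible pair of morphisms has as union of graphs a single-valued total relation, which is the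
graph of the induced morphism (`isPushout_of_sup_eq_top`). So pushouts of monos exist, and as they
are unique, every one of them has monic coprojections and is a pullback square
(`mono_mono_isPullback_of_isPushout`).

*The model.* Sethood makes the membership relation of `N` a relation between `N` and `S^N`, whose
classifying morphism `χ` is monic by extensionality. Since the pushout `M` of `N` and `PN` over
`S^N` is a pullback square, an element of `N` is a class in `M` exactly when it is a set, and then
it has the same elements as before. Hence, on `N`, a formula with quantifiers bounded to `Setom`
means the same in `M` as its evident translation into the language of set theory means in `N`
(`CatStructure.IsClassExtension.forces_bound_iff`). The translation preserves stratification, so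
set comprehension in `M` follows from comprehension in `N`. Class comprehension is the universal
property of `PN`: the interpretation of any formula whatsoever is classified by a morphism to `PN`.
The other axioms are read off from the forcing clauses.
-/

namespace NFTopos

variable {C : Type u} [Category.{w} C]

/-! ### Generalised elements of subobjects -/

section Elements

attribute [local simp] prod.lift_fst prod.lift_snd prod.lift_fst_assoc prod.lift_snd_assoc

theorem factors_mk {X Y T : C} (f : X ⟶ Y) [Mono f] (h : T ⟶ Y) :
    (Subobject.mk f).Factors h ↔ ∃ k : T ⟶ X, k ≫ f = h :=
  Subobject.mk_factors_iff f h

theorem isCover_id (X : C) : IsCover (𝟙 X) := by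
  intro I m g _ e
  have : IsSplitEpi m := ⟨⟨⟨g, e⟩⟩⟩
  exact isIso_of_mono_of_isSplitEpi m

theorem eq_top_iff_factors {X : C} {A : Subobject X} :
    A = ⊤ ↔ ∀ {T : C} (h : T ⟶ X), A.Factors h := by
  rw [← top_le_iff, le_iff_factors]
  exact ⟨fun H _ h => H h (Subobject.top_factors _), fun H _ h _ => H h⟩

/-- A pullback square stays one when its common codomain is embedded in a larger object. -/
theorem isPullback_of_comp_mono {S N P M K : C} {a : S ⟶ N} {b : S ⟶ P} {i : N ⟶ M} {j : P ⟶ M}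
    (d : M ⟶ K) [Mono d] (sq : IsPullback a b (i ≫ d) (j ≫ d)) : IsPullback a b i j := by
  refine ⟨⟨?_⟩, ⟨PullbackCone.IsLimit.mk _ (fun s => sq.lift s.fst s.snd ?_)
    (fun s => sq.lift_fst _ _ _) (fun s => sq.lift_snd _ _ _) fun s k h₁ h₂ => ?_⟩⟩
  · rw [← cancel_mono d]
    simpa using sq.w
  · rw [reassoc_of% s.condition]
  · apply sq.hom_ext
    · rw [h₁, sq.lift_fst]
    · rw [h₂, sq.lift_snd]

variable [IsTopos C]

theorem factors_forallAlong {X Y T : C} (f : X ⟶ Y) (A : Subobject X) (h : T ⟶ Y) :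
    (forallAlong f A).Factors h ↔
      ∀ {T' : C} (a : T' ⟶ T) (x : T' ⟶ X), a ≫ h = x ≫ f → A.Factors x := by
  obtain ⟨B, hB⟩ := exists_forall f A
  constructor
  · intro H T' a x e
    refine le_iff_factors.1 ((forallAlong_gc f).l_u_le A) x ?_
    rw [factors_pullback, ← e]
    exact Subobject.factors_of_factors_right a H
  · intro H
    refine le_iff_factors.1 (((forallAlong_gc f).le_iff_le (a := B)).1 ?_) h ((hB h).2 H)
    refine le_iff_factors.2 fun {T} x hx => ?_
    rw [factors_pullback] at hx
    exact (hB _).1 hx (𝟙 _) x (Category.id_comp _)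

theorem factors_himp {X T : C} (A B : Subobject X) (h : T ⟶ X) :
    (A ⇨ B).Factors h ↔ ∀ {T' : C} (a : T' ⟶ T), A.Factors (a ≫ h) → B.Factors (a ≫ h) := by
  obtain ⟨D, hD⟩ := exists_imp A B
  constructor
  · intro H T' a ha
    refine le_iff_factors.1 (himp_inf_le (a := A) (b := B)) _ ((Subobject.inf_factors _).2 ⟨?_, ha⟩)
    exact Subobject.factors_of_factors_right a H
  · intro H
    refine le_iff_factors.1 (le_himp_iff.2 (le_iff_factors.2 fun {T} x hx => ?_)) h ((hD h).2 H)
    obtain ⟨h₁, h₂⟩ := (Subobject.inf_factors _).1 hx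
    simpa using (hD x).1 h₁ (𝟙 _) (by simpa using h₂)

/-- Membership in a subobject is local for covers. -/
theorem IsCover.factors {X T T' : C} {c : T' ⟶ T} (hc : IsCover c) (A : Subobject X) (h : T ⟶ X)
    (H : A.Factors (c ≫ h)) : A.Factors h := by
  rw [← factors_pullback] at H
  have := hc ((Subobject.pullback h).obj A).arrow (Subobject.factorThru _ c H) inferInstance
    (by simp)
  rw [Subobject.isIso_arrow_iff_eq_top] at this
  have h' := (factors_pullback h A (𝟙 T)).1 (this ▸ Subobject.top_factors _)
  simpa using h'

/-- An element of the image of `A` comes from `A` on a cover. -/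
theorem factors_existsAlong {X Y T : C} (f : X ⟶ Y) (A : Subobject X) (h : T ⟶ Y) :
    (existsAlong f A).Factors h ↔
      ∃ (T' : C) (c : T' ⟶ T) (x : T' ⟶ X), IsCover c ∧ c ≫ h = x ≫ f ∧ A.Factors x := by
  have unit : ∀ {S : C} (x : S ⟶ X), A.Factors x → (existsAlong f A).Factors (x ≫ f) := by
    intro S x hx
    rw [← factors_pullback]
    exact le_iff_factors.1 ((existsAlong_gc f).le_u_l A) x hx
  constructor
  · intro H
    have hA := unit A.arrow (Subobject.factors_self A)
    let e := (existsAlong f A).factorThru _ hA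
    -- `A` covers its image along `f`, hence so does its inverse image along `h`
    have he : IsCover e := by
      intro I m g _ hg
      have le : existsAlong f A ≤ Subobject.mk (m ≫ (existsAlong f A).arrow) := by
        rw [(existsAlong_gc f).le_iff_le]
        refine le_iff_factors.2 fun {S} x hx => ?_
        rw [factors_pullback, factors_mk]
        refine ⟨A.factorThru x hx ≫ g, ?_⟩
        rw [Category.assoc, reassoc_of% hg]
        simp [e]
      have fac := le_iff_factors.1 le _ (Subobject.factors_self _)
      obtain ⟨k, hk⟩ := (factors_mk _ _).1 fac
      have hk' : k ≫ m = 𝟙 _ := by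
        rw [← cancel_mono (existsAlong f A).arrow]
        simpa using hk
      have : IsSplitEpi m := ⟨⟨⟨k, hk'⟩⟩⟩
      exact isIso_of_mono_of_isSplitEpi m
    let k := (existsAlong f A).factorThru h H
    have sq := IsPullback.of_hasPullback e k
    refine ⟨_, pullback.snd e k, pullback.fst e k ≫ A.arrow,
      HeytingCategory.isCover_of_isPullback sq he, ?_, Subobject.factors_comp_arrow _⟩
    have := congrArg (· ≫ (existsAlong f A).arrow) sq.w
    simpa [e, k] using this.symm
  · rintro ⟨T', c, x, hc, e, hx⟩
    refine hc.factors _ _ ?_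
    rw [e]
    exact unit x hx

theorem factors_iff_pullback_eq_top {X T : C} (A : Subobject X) (h : T ⟶ X) :
    A.Factors h ↔ (Subobject.pullback h).obj A = ⊤ := by
  rw [eq_top_iff_factors]
  simp only [factors_pullback]
  exact ⟨fun H _ k => Subobject.factors_of_factors_right k H, fun H => by simpa using H (𝟙 T)⟩

/-- An element of the least subobject has a domain on which everything holds. -/
theorem factors_bot {X T : C} (h : T ⟶ X) :
    (⊥ : Subobject X).Factors h ↔ ∀ D : Subobject T, D = ⊤ := by
  have hb : IsBot ((Subobject.pullback h).obj (⊥ : Subobject X)) :=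
    HeytingCategory.pullback_isBot h _ isBot_bot
  rw [factors_iff_pullback_eq_top]
  exact ⟨fun H D => top_le_iff.1 (H ▸ hb D), fun H => H _⟩

/-- Proof by cases: `h` lies in `A ⊔ B` when every property of elements of the domain of `h` that
holds wherever `h` lies in `A` and wherever `h` lies in `B` holds throughout. -/
theorem factors_sup {X T : C} (A B : Subobject X) (h : T ⟶ X) :
    (A ⊔ B).Factors h ↔ ∀ D : Subobject T,
      (∀ {T' : C} (a : T' ⟶ T), A.Factors (a ≫ h) → D.Factors a) →
      (∀ {T' : C} (a : T' ⟶ T), B.Factors (a ≫ h) → D.Factors a) → D = ⊤ := by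
  have lub := HeytingCategory.pullback_isLUB h A B (A ⊔ B) isLUB_pair
  rw [factors_iff_pullback_eq_top]
  constructor
  · intro H D hA hB
    rw [← top_le_iff, ← H, isLUB_le_iff lub]
    rintro _ (rfl | rfl)
    · exact le_iff_factors.2 fun x hx => hA x ((factors_pullback _ _ _).1 hx)
    · exact le_iff_factors.2 fun x hx => hB x ((factors_pullback _ _ _).1 hx)
  · intro H
    exact H _
      (fun a ha => le_iff_factors.1 (lub.1 (by simp)) a ((factors_pullback _ _ _).2 ha))
      (fun a ha => le_iff_factors.1 (lub.1 (by simp)) a ((factors_pullback _ _ _).2 ha))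

theorem factors_mk_diag {X T : C} (f g : T ⟶ X) :
    (Subobject.mk (diag X)).Factors (prod.lift f g) ↔ f = g := by
  rw [factors_mk]
  constructor
  · rintro ⟨k, hk⟩
    have h₁ := congrArg (· ≫ prod.fst) hk
    have h₂ := congrArg (· ≫ prod.snd) hk
    simp at h₁ h₂
    rw [← h₁, ← h₂]
  · rintro rfl
    exact ⟨f, by simp⟩

theorem eq_of_equalizer_eq_top {X Y : C} {f g : X ⟶ Y}
    (h : Subobject.mk (equalizer.ι f g) = ⊤) : f = g := by
  have : IsIso (equalizer.ι f g) := (Subobject.isIso_iff_mk_eq_top _).2 h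
  exact eq_of_epi_equalizer

theorem factors_equalizer {X Y T : C} (f g : X ⟶ Y) (h : T ⟶ X) :
    (Subobject.mk (equalizer.ι f g)).Factors h ↔ h ≫ f = h ≫ g := by
  rw [factors_mk]
  constructor
  · rintro ⟨k, hk⟩
    rw [← hk, Category.assoc, Category.assoc, equalizer.condition]
  · intro e
    exact ⟨equalizer.lift h e, equalizer.lift_ι h e⟩

/-- Covers are epimorphisms: an equation that holds on a cover holds. -/
theorem IsCover.hom_ext {X T T' : C} {c : T' ⟶ T} (hc : IsCover c) {f g : T ⟶ X}
    (H : c ≫ f = c ≫ g) : f = g := by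
  have := hc.factors (Subobject.mk (equalizer.ι f g)) (𝟙 T)
    ((factors_equalizer _ _ _).2 (by simpa using H))
  simpa using (factors_equalizer _ _ _).1 this

end Elements

/-! ### Power objects -/

section PowerObjects

attribute [local simp] prod.lift_fst prod.lift_snd prod.lift_fst_assoc prod.lift_snd_assoc

variable [HasFiniteLimits C]

/-- The generalised element `x` of `A` belongs to the generalised element `y` of the power object
`PA` with membership relation `m`. -/
def MemElem {A PA mem : C} (m : mem ⟶ A ⨯ PA) {T : C} (x : T ⟶ A) (y : T ⟶ PA) : Prop :=
  ∃ q : T ⟶ mem, q ≫ m = prod.lift x y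

theorem lift_map_id {A B D T : C} (x : T ⟶ A) (y : T ⟶ B) (χ : B ⟶ D) :
    prod.lift x y ≫ prod.map (𝟙 A) χ = prod.lift x (y ≫ χ) := by simp

theorem eq_lift {A B T : C} (z : T ⟶ A ⨯ B) : z = prod.lift (z ≫ prod.fst) (z ≫ prod.snd) := by
  apply Limits.prod.hom_ext <;> simp

/-- A mono `r` is the pullback of `m` along `𝟙 × χ` exactly when it has the right generalised
elements. -/
theorem exists_isPullback_iff {A B PA mem R : C} (m : mem ⟶ A ⨯ PA) [Mono m] (r : R ⟶ A ⨯ B)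
    [Mono r] (χ : B ⟶ PA) :
    (∃ t, IsPullback t r m (prod.map (𝟙 A) χ)) ↔
      ∀ {T : C} (x : T ⟶ A) (y : T ⟶ B),
        MemElem m x (y ≫ χ) ↔ ∃ q : T ⟶ R, q ≫ r = prod.lift x y := by
  constructor
  · rintro ⟨t, sq⟩ T x y
    constructor
    · rintro ⟨q, hq⟩
      have e : q ≫ m = prod.lift x y ≫ prod.map (𝟙 A) χ := by rw [hq, lift_map_id]
      exact ⟨sq.lift _ _ e, sq.lift_snd _ _ e⟩
    · rintro ⟨q, hq⟩
      exact ⟨q ≫ t, by rw [Category.assoc, sq.w, reassoc_of% hq, lift_map_id]⟩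
  · intro H
    obtain ⟨t, ht⟩ := (H (r ≫ prod.fst) (r ≫ prod.snd)).2 ⟨𝟙 _, by rw [← eq_lift]; simp⟩
    have w : t ≫ m = r ≫ prod.map (𝟙 A) χ := by
      rw [ht, ← lift_map_id, ← eq_lift]
    have L : ∀ s : PullbackCone m (prod.map (𝟙 A) χ), ∃ q, q ≫ r = s.snd := by
      intro s
      rw [eq_lift s.snd]
      refine (H _ _).1 ⟨s.fst, ?_⟩
      rw [s.condition, ← lift_map_id, ← eq_lift]
    choose l hl using L
    refine ⟨t, ⟨⟨w⟩, ⟨PullbackCone.IsLimit.mk _ l (fun s => ?_) hl fun s k _ hk => ?_⟩⟩⟩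
    · rw [← cancel_mono m, Category.assoc, w, reassoc_of% (hl s), s.condition]
    · rw [← cancel_mono r, hk, hl]

variable {A PA mem : C} {m : mem ⟶ A ⨯ PA}

/-- Every relation between `A` and `B` is classified by a morphism from `B` to the power object. -/
theorem IsPowerObject.exists_classify (hm : IsPowerObject m) {B R : C} (r : R ⟶ A ⨯ B) [Mono r] :
    ∃ χ : B ⟶ PA, ∀ {T : C} (x : T ⟶ A) (y : T ⟶ B),
      MemElem m x (y ≫ χ) ↔ ∃ q : T ⟶ R, q ≫ r = prod.lift x y := by
  have := hm.mono
  obtain ⟨χ, h, -⟩ := hm.existsUnique_classifying r inferInstance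
  exact ⟨χ, (exists_isPullback_iff m r χ).1 h⟩

/-- Two generalised elements of a power object with the same generalised elements are equal. -/
theorem IsPowerObject.ext (hm : IsPowerObject m) {T : C} {y y' : T ⟶ PA}
    (H : ∀ {T' : C} (a : T' ⟶ T) (x : T' ⟶ A), MemElem m x (a ≫ y) ↔ MemElem m x (a ≫ y')) :
    y = y' := by
  have := hm.mono
  let r := pullback.snd m (prod.map (𝟙 A) y)
  have h₁ : ∃ t, IsPullback t r m (prod.map (𝟙 A) y) := ⟨_, IsPullback.of_hasPullback _ _⟩
  refine (hm.existsUnique_classifying r inferInstance).unique h₁ ?_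
  rw [exists_isPullback_iff] at h₁ ⊢
  exact fun x a => (H a x).symm.trans (h₁ x a)

end PowerObjects

/-! ### Pushouts of monos -/

section Pushouts

attribute [local simp] prod.lift_fst prod.lift_snd prod.lift_fst_assoc prod.lift_snd_assoc

variable [IsTopos C]

/-- Unions of subobjects are effective: a pullback square of monos that are jointly surjective is
a pushout square. -/
theorem isPushout_of_sup_eq_top {S N P M : C} {a : S ⟶ N} {b : S ⟶ P} {i : N ⟶ M} {j : P ⟶ M}
    [Mono i] [Mono j] (sq : IsPullback a b i j) (H : Subobject.mk i ⊔ Subobject.mk j = ⊤) :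
    IsPushout a b i j := by
  have uniq : ∀ {T : C} (d d' : M ⟶ T), i ≫ d = i ≫ d' → j ≫ d = j ≫ d' → d = d' := by
    intro T d d' h₁ h₂
    apply eq_of_equalizer_eq_top
    rw [← top_le_iff, ← H]
    refine sup_le (le_iff_factors.2 ?_) (le_iff_factors.2 ?_)
    · rintro X x hx
      obtain ⟨k, hk⟩ := (factors_mk _ _).1 hx
      rw [factors_equalizer, ← hk, Category.assoc, h₁, Category.assoc]
    · rintro X x hx
      obtain ⟨k, hk⟩ := (factors_mk _ _).1 hx
      rw [factors_equalizer, ← hk, Category.assoc, h₂, Category.assoc]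
  have exist : ∀ {T : C} (f : N ⟶ T) (g : P ⟶ T), a ≫ f = b ≫ g →
      ∃ d : M ⟶ T, i ≫ d = f ∧ j ≫ d = g := by
    intro T f g e
    have : Mono (prod.lift i f) := mono_of_mono_fac (prod.lift_fst i f)
    have : Mono (prod.lift j g) := mono_of_mono_fac (prod.lift_fst j g)
    -- the union of the graphs of `f` and `g`, which is the graph of the induced morphism
    let F := Subobject.mk (prod.lift i f)
    let G := Subobject.mk (prod.lift j g)
    have hF : ∀ {X : C} (z : X ⟶ M ⨯ T), F.Factors z →
        ∃ n, n ≫ i = z ≫ prod.fst ∧ n ≫ f = z ≫ prod.snd := by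
      intro X z hz
      obtain ⟨n, hn⟩ := (factors_mk _ _).1 hz
      exact ⟨n, by simp [← hn], by simp [← hn]⟩
    have hG : ∀ {X : C} (z : X ⟶ M ⨯ T), G.Factors z →
        ∃ p, p ≫ j = z ≫ prod.fst ∧ p ≫ g = z ≫ prod.snd := by
      intro X z hz
      obtain ⟨n, hn⟩ := (factors_mk _ _).1 hz
      exact ⟨n, by simp [← hn], by simp [← hn]⟩
    have glue : ∀ {X : C} (n : X ⟶ N) (p : X ⟶ P), n ≫ i = p ≫ j → n ≫ f = p ≫ g := by
      intro X n p h
      rw [← sq.lift_fst n p h, Category.assoc, e, ← Category.assoc, sq.lift_snd]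
    let r := (F ⊔ G).arrow ≫ prod.fst
    -- the union is single-valued: an element of either graph agrees with one of the same graph
    -- because `i` and `j` are monic, and with one of the other because of the pullback square
    have single : ∀ {X : C} (y z : X ⟶ M ⨯ T), (F ⊔ G).Factors y → (F ⊔ G).Factors z →
        y ≫ prod.fst = z ≫ prod.fst → y ≫ prod.snd = z ≫ prod.snd := by
      intro X y z hy hz h
      apply eq_of_equalizer_eq_top
      refine (factors_sup F G y).1 hy _ (fun {X₁} c hc => ?_) (fun {X₁} c hc => ?_)
      · obtain ⟨n, hn₁, hn₂⟩ := hF _ hc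
        rw [factors_equalizer]
        have hz' := Subobject.factors_of_factors_right (P := F ⊔ G) c hz
        apply eq_of_equalizer_eq_top
        refine (factors_sup F G _).1 hz' _ (fun {X₂} d hd => ?_) (fun {X₂} d hd => ?_)
        · obtain ⟨n', hn₁', hn₂'⟩ := hF _ hd
          have : n' = d ≫ n := by
            rw [← cancel_mono i, hn₁']; simp [hn₁, h]
          rw [factors_equalizer]
          simp only [Category.assoc] at hn₂ hn₂'
          rw [← hn₂, ← hn₂', this, Category.assoc]
        · obtain ⟨p, hp₁, hp₂⟩ := hG _ hd
          have := glue (d ≫ n) p (by rw [Category.assoc, hn₁, hp₁]; simp [h])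
          rw [factors_equalizer]
          simp only [Category.assoc] at hn₂ hp₂ this
          rw [← hn₂, ← hp₂, this]
      · obtain ⟨p, hp₁, hp₂⟩ := hG _ hc
        rw [factors_equalizer]
        have hz' := Subobject.factors_of_factors_right (P := F ⊔ G) c hz
        apply eq_of_equalizer_eq_top
        refine (factors_sup F G _).1 hz' _ (fun {X₂} d hd => ?_) (fun {X₂} d hd => ?_)
        · obtain ⟨n, hn₁, hn₂⟩ := hF _ hd
          have := glue n (d ≫ p) (by rw [Category.assoc, hp₁, hn₁]; simp [h])
          rw [factors_equalizer]
          simp only [Category.assoc] at hn₂ hp₂ this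
          rw [← hn₂, ← hp₂, this]
        · obtain ⟨p', hp₁', hp₂'⟩ := hG _ hd
          have : p' = d ≫ p := by
            rw [← cancel_mono j, hp₁']; simp [hp₁, h]
          rw [factors_equalizer]
          simp only [Category.assoc] at hp₂ hp₂'
          rw [← hp₂, ← hp₂', this, Category.assoc]
    have hr : Mono r := by
      refine ⟨fun y z h => ?_⟩
      rw [← cancel_mono (F ⊔ G).arrow]
      have h' : (y ≫ (F ⊔ G).arrow) ≫ prod.fst = (z ≫ (F ⊔ G).arrow) ≫ prod.fst := by
        simpa [r] using h
      exact Limits.prod.hom_ext h' (single _ _ (Subobject.factors_comp_arrow _)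
        (Subobject.factors_comp_arrow _) h')
    have fF : (F ⊔ G).Factors (prod.lift i f) :=
      Subobject.factors_of_le _ le_sup_left ((factors_mk _ _).2 ⟨𝟙 _, Category.id_comp _⟩)
    have fG : (F ⊔ G).Factors (prod.lift j g) :=
      Subobject.factors_of_le _ le_sup_right ((factors_mk _ _).2 ⟨𝟙 _, Category.id_comp _⟩)
    have hri : (F ⊔ G).factorThru _ fF ≫ r = i := by simp [r]
    have hrj : (F ⊔ G).factorThru _ fG ≫ r = j := by simp [r]
    -- it is total, because its domain contains both `N` and `P`
    have : IsIso r := by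
      rw [Subobject.isIso_iff_mk_eq_top, ← top_le_iff, ← H]
      refine sup_le (Subobject.mk_le_mk_of_comm _ hri) (Subobject.mk_le_mk_of_comm _ hrj)
    refine ⟨inv r ≫ (F ⊔ G).arrow ≫ prod.snd, ?_, ?_⟩
    · rw [← hri]; simp
    · rw [← hrj]; simp
  refine ⟨⟨sq.w⟩, ⟨PushoutCocone.IsColimit.mk _
    (fun s => (exist s.inl s.inr s.condition).choose)
    (fun s => (exist s.inl s.inr s.condition).choose_spec.1)
    (fun s => (exist s.inl s.inr s.condition).choose_spec.2)
    fun s d h₁ h₂ => uniq _ _ ?_ ?_⟩⟩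
  · rw [h₁, (exist s.inl s.inr s.condition).choose_spec.1]
  · rw [h₂, (exist s.inl s.inr s.condition).choose_spec.2]

/-- Two monos `a : S ⟶ N` and `b : S ⟶ P` embed into a common object, with intersection `S`: an
element `n` of `N` is sent to the pair of `{n}` and `{p | ∃ s, a s = n ∧ b s = p}` in `PN ⨯ PP`,
and symmetrically for `P`. -/
theorem exists_amalgam {S N P : C} (a : S ⟶ N) (b : S ⟶ P) [Mono a] [Mono b] :
    ∃ (K : C) (i : N ⟶ K) (j : P ⟶ K), Mono i ∧ Mono j ∧ IsPullback a b i j := by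
  obtain ⟨PN, memN, mN, hN⟩ := IsTopos.exists_powerObject N
  obtain ⟨PP, memP, mP, hP⟩ := IsTopos.exists_powerObject P
  have : Mono (prod.lift a b) := mono_of_mono_fac (prod.lift_fst a b)
  have : Mono (prod.lift b a) := mono_of_mono_fac (prod.lift_fst b a)
  obtain ⟨σN, hσN⟩ := hN.exists_classify (diag N)
  obtain ⟨σP, hσP⟩ := hP.exists_classify (diag P)
  obtain ⟨αN, hαN⟩ := hN.exists_classify (prod.lift a b)
  obtain ⟨αP, hαP⟩ := hP.exists_classify (prod.lift b a)
  have diag_iff : ∀ {X T : C} (x y : T ⟶ X), (∃ q, q ≫ diag X = prod.lift x y) ↔ x = y := by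
    intro X T x y
    rw [← factors_mk_diag, factors_mk]
  have lift_iff : ∀ {X Y T : C} (f : S ⟶ X) (g : S ⟶ Y) (x : T ⟶ X) (y : T ⟶ Y),
      (∃ q, q ≫ prod.lift f g = prod.lift x y) ↔ ∃ q, q ≫ f = x ∧ q ≫ g = y := by
    intro X Y T f g x y
    refine exists_congr fun q => ⟨fun h => ⟨?_, ?_⟩, fun h => by simp [h.1, h.2]⟩
    · simpa using congrArg (· ≫ prod.fst) h
    · simpa using congrArg (· ≫ prod.snd) h
  simp only [diag_iff] at hσN hσP
  simp only [lift_iff] at hαN hαP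
  have iσN : ∀ {T : C} (x y : T ⟶ N), x ≫ σN = y ≫ σN → x = y := fun x y h =>
    (hσN x y).1 (h ▸ (hσN x x).2 rfl)
  have iσP : ∀ {T : C} (x y : T ⟶ P), x ≫ σP = y ≫ σP → x = y := fun x y h =>
    (hσP x y).1 (h ▸ (hσP x x).2 rfl)
  have wN : a ≫ σN = b ≫ αN := hN.ext fun c x => by
    rw [← Category.assoc, ← Category.assoc, hσN, hαN]
    refine ⟨fun h => ⟨c, h.symm, rfl⟩, ?_⟩
    rintro ⟨q, rfl, hq⟩
    rw [(cancel_mono b).1 hq]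
  have wP : a ≫ αP = b ≫ σP := hP.ext fun c x => by
    rw [← Category.assoc, ← Category.assoc, hσP, hαP]
    refine ⟨?_, fun h => ⟨c, h.symm, rfl⟩⟩
    rintro ⟨q, rfl, hq⟩
    rw [(cancel_mono a).1 hq]
  have mi : Mono (prod.lift σN αP) := ⟨fun x y h => iσN x y (by
    simpa using congrArg (· ≫ prod.fst) h)⟩
  have mj : Mono (prod.lift αN σP) := ⟨fun x y h => iσP x y (by
    simpa using congrArg (· ≫ prod.snd) h)⟩
  have w : a ≫ prod.lift σN αP = b ≫ prod.lift αN σP := by simp [wN, wP]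
  have L : ∀ s : PullbackCone (prod.lift σN αP) (prod.lift αN σP),
      ∃ q, q ≫ a = s.fst ∧ q ≫ b = s.snd := by
    intro s
    have e : s.fst ≫ σN = s.snd ≫ αN := by
      simpa using congrArg (· ≫ prod.fst) s.condition
    rw [← hαN, ← e, hσN]
  choose l hl using L
  exact ⟨PN ⨯ PP, _, _, mi, mj, ⟨⟨w⟩, ⟨PullbackCone.IsLimit.mk _ l (fun s => (hl s).1)
    (fun s => (hl s).2) fun s k hk _ => (cancel_mono a).1 (hk.trans (hl s).1.symm)⟩⟩⟩

/-- Any two monos with the same domain have a pushout, which is moreover a pullback square of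
monos. -/
theorem exists_isPushout_isPullback {S N P : C} (a : S ⟶ N) (b : S ⟶ P) [Mono a] [Mono b] :
    ∃ (M : C) (i : N ⟶ M) (j : P ⟶ M),
      Mono i ∧ Mono j ∧ IsPullback a b i j ∧ IsPushout a b i j := by
  obtain ⟨K, i, j, mi, mj, sq⟩ := exists_amalgam a b
  let U := Subobject.mk i ⊔ Subobject.mk j
  have fi : U.Factors i := Subobject.factors_of_le i le_sup_left
    ((factors_mk _ _).2 ⟨𝟙 _, Category.id_comp _⟩)
  have fj : U.Factors j := Subobject.factors_of_le j le_sup_right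
    ((factors_mk _ _).2 ⟨𝟙 _, Category.id_comp _⟩)
  let i' := U.factorThru i fi
  let j' := U.factorThru j fj
  have ei : i' ≫ U.arrow = i := by simp [i']
  have ej : j' ≫ U.arrow = j := by simp [j']
  have mi' : Mono i' := mono_of_mono_fac ei
  have mj' : Mono j' := mono_of_mono_fac ej
  have sq' : IsPullback a b i' j' := by
    rw [← ei, ← ej] at sq
    exact isPullback_of_comp_mono _ sq
  refine ⟨_, i', j', mi', mj', sq', isPushout_of_sup_eq_top sq' ?_⟩
  -- the union of `N` and `P` inside `U`, embedded in `K`, contains both images, hence `U`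
  have le : U ≤ Subobject.mk ((Subobject.mk i' ⊔ Subobject.mk j').arrow ≫ U.arrow) := by
    refine sup_le (Subobject.mk_le_mk_of_comm
      (Subobject.factorThru (Subobject.mk i' ⊔ Subobject.mk j') i' ?_) ?_)
      (Subobject.mk_le_mk_of_comm
      (Subobject.factorThru (Subobject.mk i' ⊔ Subobject.mk j') j' ?_) ?_)
    · exact Subobject.factors_of_le i' le_sup_left
        ((factors_mk _ _).2 ⟨𝟙 _, Category.id_comp _⟩)
    · simp [ei]
    · exact Subobject.factors_of_le j' le_sup_right
        ((factors_mk _ _).2 ⟨𝟙 _, Category.id_comp _⟩)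
    · simp [ej]
  obtain ⟨k, hk⟩ := (factors_mk _ _).1 (le_iff_factors.1 le _ (Subobject.factors_self _))
  have hk' : k ≫ (Subobject.mk i' ⊔ Subobject.mk j').arrow = 𝟙 _ := by
    rw [← cancel_mono U.arrow]
    simpa using hk
  rw [factors_iff_pullback_eq_top (A := Subobject.mk i' ⊔ Subobject.mk j') (h := 𝟙 _) |>.1
    (hk' ▸ Subobject.factors_comp_arrow k) |>.symm, Subobject.pullback_id]

theorem hasPushout_of_mono {S N P : C} (a : S ⟶ N) (b : S ⟶ P) [Mono a] [Mono b] :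
    HasPushout a b := by
  obtain ⟨M, i, j, -, -, -, h⟩ := exists_isPushout_isPullback a b
  exact h.hasPushout

/-- In every pushout square of monos, by comparison with the one constructed, the coprojections
are monic and the square is a pullback. -/
theorem mono_mono_isPullback_of_isPushout {S N P M : C} {a : S ⟶ N} {b : S ⟶ P} [Mono a] [Mono b]
    {i : N ⟶ M} {j : P ⟶ M} (h : IsPushout a b i j) : Mono i ∧ Mono j ∧ IsPullback a b i j := by
  obtain ⟨M₀, i₀, j₀, mi, mj, sq, h₀⟩ := exists_isPushout_isPullback a b
  let d := h.desc i₀ j₀ h₀.w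
  have ei : i ≫ d = i₀ := h.inl_desc _ _ _
  have ej : j ≫ d = j₀ := h.inr_desc _ _ _
  have : Mono d := by
    have : d ≫ h₀.desc i j h.w = 𝟙 _ := by
      apply h.hom_ext
      · rw [← Category.assoc, ei, h₀.inl_desc, Category.comp_id]
      · rw [← Category.assoc, ej, h₀.inr_desc, Category.comp_id]
    exact mono_of_mono_fac this
  refine ⟨mono_of_mono_fac ei, mono_of_mono_fac ej, ?_⟩
  rw [← ei, ← ej] at sq
  exact isPullback_of_comp_mono _ sq

end Pushouts

/-! ### Kripke–Joyal semantics -/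

section Forcing

namespace CatStructure

/-- The context `h` extended by a value `x` for the last variable. -/
def extend {n : ℕ} {T X : C} (h : Fin n → (T ⟶ X)) (x : T ⟶ X) : Fin (n + 1) → (T ⟶ X) :=
  Fin.snoc (α := fun _ => T ⟶ X) h x

@[simp] theorem extend_last {n : ℕ} {T X : C} (h : Fin n → (T ⟶ X)) (x : T ⟶ X) :
    extend h x (Fin.last n) = x := Fin.snoc_last (α := fun _ => T ⟶ X) _ _

@[simp] theorem extend_castSucc {n : ℕ} {T X : C} (h : Fin n → (T ⟶ X)) (x : T ⟶ X) (i : Fin n) :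
    extend h x i.castSucc = h i := Fin.snoc_castSucc (α := fun _ => T ⟶ X) _ _ _

theorem comp_extend {n : ℕ} {T T' X : C} (a : T' ⟶ T) (h : Fin n → (T ⟶ X)) (x : T ⟶ X) :
    (fun i => a ≫ extend h x i) = extend (fun i => a ≫ h i) (a ≫ x) := by
  funext i
  refine Fin.lastCases ?_ (fun i => ?_) i <;> simp

theorem comp_comp_extend {n : ℕ} {T T' T'' X : C} (b : T'' ⟶ T') (a : T' ⟶ T)
    (h : Fin n → (T ⟶ X)) (x : T ⟶ X) :
    (fun i => b ≫ a ≫ extend h x i) = extend (fun i => b ≫ a ≫ h i) (b ≫ a ≫ x) := by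
  simpa only [Category.assoc] using comp_extend (b ≫ a) h x

theorem extend_comp {n : ℕ} {T X Y : C} (h : Fin n → (T ⟶ X)) (x : T ⟶ X) (f : X ⟶ Y) :
    (fun i => extend h x i ≫ f) = extend (fun i => h i ≫ f) (x ≫ f) := by
  funext i
  refine Fin.lastCases ?_ (fun i => ?_) i <;> simp

theorem extend_comp_snoc {m : ℕ} {X : C} (r : Fin n → Fin m) (h : Fin m → (T ⟶ X)) (x : T ⟶ X) :
    extend h x ∘ (Fin.snoc (fun i => (r i).castSucc) (Fin.last m) : Fin (n + 1) → Fin (m + 1)) =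
      extend (h ∘ r) x := by
  funext i
  refine Fin.lastCases ?_ (fun i => ?_) i <;> simp

theorem comp_piLift [HasFiniteLimits C] {n : ℕ} {T T' X : C} (a : T' ⟶ T) (h : Fin n → (T ⟶ X)) :
    a ≫ Pi.lift h = Pi.lift fun i => a ≫ h i :=
  Pi.hom_ext _ _ fun i => by simp

theorem eq_piLift [HasFiniteLimits C] {n : ℕ} {T X : C} (z : T ⟶ ∏ᶜ fun _ : Fin n => X) :
    z = Pi.lift fun i => z ≫ Pi.π _ i :=
  Pi.hom_ext _ _ fun i => by simp

variable [IsTopos C] {L : FirstOrder.Language.{0, 0}} (M : CatStructure C L)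

/-- The formula `φ` holds of the generalised elements `h i : T ⟶ M`: the tuple `h` factors
through the interpretation of `φ`. -/
def Forces {n : ℕ} (φ : Formula L n) {T : C} (h : Fin n → (T ⟶ M.carrier)) : Prop :=
  (M.interp φ).Factors (Pi.lift h)

/-- The value of a term at generalised elements. -/
noncomputable def eval {n : ℕ} (t : L.Term (Fin n)) {T : C} (h : Fin n → (T ⟶ M.carrier)) :
    T ⟶ M.carrier :=
  Pi.lift h ≫ M.term t

theorem models_iff (Th : Theory L) :
    M.Models Th ↔ ∀ ⦃n : ℕ⦄ (φ : Formula L n), Th φ →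
      ∀ {T : C} (h : Fin n → (T ⟶ M.carrier)), M.Forces φ h := by
  refine forall_congr' fun n => forall_congr' fun φ => forall_congr' fun _ => ?_
  rw [eq_top_iff_factors]
  refine ⟨fun H T h => H _, fun H T h => ?_⟩
  rw [eq_piLift h]
  exact H _

variable {M} {n : ℕ} {T : C} {h : Fin n → (T ⟶ M.carrier)}

@[simp] theorem eval_var (i : Fin n) : M.eval (var i) h = h i := by
  simp [eval, term]

theorem eval_func {l : ℕ} (f : L.Functions l) (ts : Fin l → L.Term (Fin n)) :
    M.eval (.func f ts) h = Pi.lift (fun i => M.eval (ts i) h) ≫ M.func f := by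
  simp only [eval, term, ← Category.assoc, comp_piLift]

theorem forces_falsum : M.Forces .falsum h ↔ ∀ D : Subobject T, D = ⊤ := factors_bot _

theorem forces_equal {t u : L.Term (Fin n)} :
    M.Forces (.equal t u) h ↔ M.eval t h = M.eval u h := by
  rw [Forces, interp, factors_pullback, prod.comp_lift, factors_mk_diag]
  rfl

theorem forces_rel {l : ℕ} {R : L.Relations l} {ts : Fin l → L.Term (Fin n)} :
    M.Forces (.rel R ts) h ↔ (M.rel R).Factors (Pi.lift fun i => M.eval (ts i) h) := by
  rw [Forces, interp, factors_pullback, comp_piLift]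
  rfl

theorem forces_and {φ ψ : Formula L n} :
    M.Forces (.and φ ψ) h ↔ M.Forces φ h ∧ M.Forces ψ h :=
  Subobject.inf_factors _

theorem forces_or {φ ψ : Formula L n} :
    M.Forces (.or φ ψ) h ↔ ∀ D : Subobject T,
      (∀ {T' : C} (a : T' ⟶ T), (M.Forces φ fun i => a ≫ h i) → D.Factors a) →
      (∀ {T' : C} (a : T' ⟶ T), (M.Forces ψ fun i => a ≫ h i) → D.Factors a) → D = ⊤ := by
  rw [Forces, interp, factors_sup]
  simp only [comp_piLift]
  rfl

theorem forces_imp {φ ψ : Formula L n} :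
    M.Forces (.imp φ ψ) h ↔ ∀ {T' : C} (a : T' ⟶ T),
      (M.Forces φ fun i => a ≫ h i) → M.Forces ψ fun i => a ≫ h i := by
  rw [Forces, interp, factors_himp]
  simp only [comp_piLift]
  rfl

theorem forces_iff {φ ψ : Formula L n} :
    M.Forces (.iff φ ψ) h ↔ ∀ {T' : C} (a : T' ⟶ T),
      (M.Forces φ fun i => a ≫ h i) ↔ M.Forces ψ fun i => a ≫ h i := by
  rw [Formula.iff, forces_and, forces_imp, forces_imp]
  exact ⟨fun H T' a => ⟨H.1 a, H.2 a⟩, fun H => ⟨fun a => (H a).1, fun a => (H a).2⟩⟩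

theorem piLift_comp_forget (k : Fin (n + 1) → (T ⟶ M.carrier)) :
    Pi.lift k ≫ M.forget n = Pi.lift fun i => k i.castSucc :=
  Pi.hom_ext _ _ fun i => by simp [forget]

/-- The tuples over `a ≫ h` are the extensions of `a ≫ h` by one more element. -/
theorem comp_eq_comp_forget_iff {T' : C} (a : T' ⟶ T) (x : T' ⟶ M.pow (n + 1)) :
    a ≫ Pi.lift h = x ≫ M.forget n ↔
      x = Pi.lift (extend (fun i => a ≫ h i) (x ≫ Pi.π _ (Fin.last n))) := by
  constructor
  · intro e
    refine Pi.hom_ext _ _ fun i => Fin.lastCases (by simp) (fun i => ?_) i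
    have := congrArg (· ≫ Pi.π _ i) e
    simpa [forget] using this.symm
  · intro e
    rw [e, piLift_comp_forget, comp_piLift]
    simp

theorem forces_all {φ : Formula L (n + 1)} :
    M.Forces (.all φ) h ↔ ∀ {T' : C} (a : T' ⟶ T) (x : T' ⟶ M.carrier),
      M.Forces φ (extend (fun i => a ≫ h i) x) := by
  rw [Forces, interp, factors_forallAlong]
  simp only [comp_eq_comp_forget_iff]
  constructor
  · intro H T' a x
    exact H a _ (by simp)
  · intro H T' a x e
    rw [e]
    exact H a _

theorem forces_ex {φ : Formula L (n + 1)} :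
    M.Forces (.ex φ) h ↔ ∃ (T' : C) (c : T' ⟶ T) (x : T' ⟶ M.carrier), IsCover c ∧
      M.Forces φ (extend (fun i => c ≫ h i) x) := by
  rw [Forces, interp, factors_existsAlong]
  simp only [comp_eq_comp_forget_iff]
  constructor
  · rintro ⟨T', c, x, hc, e, hx⟩
    rw [e] at hx
    exact ⟨T', c, _, hc, hx⟩
  · rintro ⟨T', c, x, hc, hx⟩
    exact ⟨T', c, _, hc, by simp, hx⟩

/-- An existential statement holds if it has a global witness. -/
theorem forces_ex_of {φ : Formula L (n + 1)} (x : T ⟶ M.carrier)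
    (H : M.Forces φ (extend h x)) : M.Forces (.ex φ) h :=
  forces_ex.2 ⟨T, 𝟙 T, x, isCover_id T, by simpa using H⟩

theorem forces_conj {k : ℕ} {φ : Fin k → Formula L n} :
    M.Forces (.conj φ) h ↔ ∀ i, M.Forces (φ i) h := by
  induction k with
  | zero => simp [Formula.conj, forces_imp]
  | succ k ih => rw [Formula.conj, forces_and, ih, Fin.forall_fin_succ']

theorem eval_relabel {m : ℕ} (r : Fin n → Fin m) (t : L.Term (Fin n))
    (h : Fin m → (T ⟶ M.carrier)) : M.eval (t.relabel r) h = M.eval t (h ∘ r) := by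
  induction t with
  | var i =>
    change M.eval (var (r i)) h = M.eval (var i) (h ∘ r)
    simp
  | func f ts ih =>
    change M.eval (.func f fun i => (ts i).relabel r) h = _
    rw [eval_func, eval_func]
    simp only [ih]

/-- Substitution of variables for variables. -/
theorem forces_rename {m : ℕ} (r : Fin n → Fin m) (φ : Formula L n) {T : C}
    (h : Fin m → (T ⟶ M.carrier)) : M.Forces (φ.rename r) h ↔ M.Forces φ (h ∘ r) := by
  induction φ generalizing m T with
  | falsum => rw [Formula.rename, forces_falsum, forces_falsum]
  | equal t u => rw [Formula.rename, forces_equal, forces_equal, eval_relabel, eval_relabel]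
  | rel R ts => simp only [Formula.rename, forces_rel, eval_relabel]
  | and φ ψ ih₁ ih₂ => rw [Formula.rename, forces_and, forces_and, ih₁, ih₂]
  | or φ ψ ih₁ ih₂ => simp only [Formula.rename, forces_or, ih₁, ih₂]; rfl
  | imp φ ψ ih₁ ih₂ => simp only [Formula.rename, forces_imp, ih₁, ih₂]; rfl
  | all φ ih => simp only [Formula.rename, forces_all, ih, extend_comp_snoc]; rfl
  | ex φ ih => simp only [Formula.rename, forces_ex, ih, extend_comp_snoc]; rfl

theorem forces_insertFresh (φ : Formula L (n + 1)) (x z : T ⟶ M.carrier) :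
    M.Forces φ.insertFresh (extend (extend h x) z) ↔ M.Forces φ (extend h z) := by
  rw [Formula.insertFresh, forces_rename]
  refine iff_of_eq (congrArg _ (funext fun i => ?_))
  refine Fin.lastCases ?_ (fun i => ?_) i
  · simp
  · have : (Fin.last n).castSucc.succAbove i.castSucc = i.castSucc.castSucc :=
      Fin.succAbove_of_castSucc_lt _ _ (by simp [Fin.lt_def])
    simp [this]

end CatStructure

end Forcing

/-! ### Set-theoretic structures -/

section SetStructures

attribute [local simp] prod.lift_fst prod.lift_snd prod.lift_fst_assoc prod.lift_snd_assoc

variable [IsTopos C]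

namespace CatStructure

variable {N : CatStructure C LSet}

variable {n : ℕ} {T : C} {h : Fin n → (T ⟶ N.carrier)}

theorem forces_set_isSet {t : LSet.Term (Fin n)} :
    N.Forces (LSet.isSet t) h ↔ ∃ s, s ≫ N.setsIncl = N.eval t h := by
  rw [LSet.isSet, forces_rel]
  constructor
  · intro H
    refine ⟨(N.rel SetRelSymb.isSet).factorThru _ H, ?_⟩
    simp [setsIncl]
  · rintro ⟨s, hs⟩
    have : (Pi.lift fun i : Fin 1 => N.eval (![t] i) h) = s ≫ (N.rel SetRelSymb.isSet).arrow := by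
      refine Pi.hom_ext _ _ fun i => ?_
      obtain rfl : i = 0 := Subsingleton.elim _ _
      simpa [setsIncl] using hs.symm
    rw [this]
    exact Subobject.factors_comp_arrow _

theorem forces_set_mem {t t' : LSet.Term (Fin n)} :
    N.Forces (LSet.mem t t') h ↔
      ∃ q, q ≫ N.memIncl = prod.lift (N.eval t h) (N.eval t' h) := by
  rw [LSet.mem, forces_rel]
  constructor
  · intro H
    refine ⟨(N.rel SetRelSymb.mem).factorThru _ H, ?_⟩
    apply Limits.prod.hom_ext <;> simp [memIncl]
  · rintro ⟨q, hq⟩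
    have : (Pi.lift fun i : Fin 2 => N.eval (![t, t'] i) h) =
        q ≫ (N.rel SetRelSymb.mem).arrow := by
      refine Pi.hom_ext _ _ fun i => ?_
      fin_cases i
      · simpa [memIncl] using (congrArg (· ≫ prod.fst) hq).symm
      · simpa [memIncl] using (congrArg (· ≫ prod.snd) hq).symm
    rw [this]
    exact Subobject.factors_comp_arrow _

theorem eval_pair {t t' : LSet.Term (Fin n)} :
    N.eval (LSet.pair t t') h = prod.lift (N.eval t h) (N.eval t' h) ≫ N.pairing := by
  rw [LSet.pair, eval_func, pairing, ← Category.assoc, comp_piLift]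
  congr 2
  funext i
  fin_cases i <;> simp

variable (N) in
/-- The generalised element `z` of `N` belongs to `x`. -/
def SetMem {T : C} (z x : T ⟶ N.carrier) : Prop := ∃ q, q ≫ N.memIncl = prod.lift z x

theorem mono_memIncl : Mono N.memIncl := by
  have : Mono (prod.lift (Pi.π (fun _ : Fin 2 => N.carrier) 0) (Pi.π _ 1)) := ⟨fun a b e => by
    refine Pi.hom_ext _ _ fun i => ?_
    fin_cases i
    · simpa using congrArg (· ≫ prod.fst) e
    · simpa using congrArg (· ≫ prod.snd) e⟩
  unfold memIncl
  infer_instance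

theorem Models.exists_set_of_setMem (hN : N.Models NFU) {T : C} {z x : T ⟶ N.carrier}
    (H : N.SetMem z x) : ∃ s, s ≫ N.setsIncl = x := by
  have := forces_imp.1 ((models_iff N NFU).1 hN _ NFU.sethood ![z, x]) (𝟙 T)
  rw [forces_set_mem, forces_set_isSet] at this
  simpa using this (by simpa [SetMem] using H)

theorem Models.set_ext (hN : N.Models NFU) {T : C} {s s' : T ⟶ N.sets}
    (H : ∀ {T' : C} (a : T' ⟶ T) (z : T' ⟶ N.carrier),
      N.SetMem z (a ≫ s ≫ N.setsIncl) ↔ N.SetMem z (a ≫ s' ≫ N.setsIncl)) : s = s' := by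
  have := forces_imp.1 ((models_iff N NFU).1 hN _ NFU.extensionality
    ![s ≫ N.setsIncl, s' ≫ N.setsIncl]) (𝟙 T)
  rw [forces_and, forces_and, forces_set_isSet, forces_set_isSet, forces_equal, forces_all] at this
  rw [← cancel_mono N.setsIncl]
  simp only [eval_var, Category.id_comp] at this
  refine this ⟨⟨s, rfl⟩, ⟨s', rfl⟩, fun {T'} a z => ?_⟩
  rw [forces_iff]
  intro T'' b
  rw [forces_set_mem, forces_set_mem]
  simp only [eval_var]
  have := H (b ≫ a) (b ≫ z)
  simp only [Category.assoc] at this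
  exact this

theorem Models.pair_injective (hN : N.Models NFU) {T : C} {x y x' y' : T ⟶ N.carrier}
    (H : prod.lift x y ≫ N.pairing = prod.lift x' y' ≫ N.pairing) : x = x' ∧ y = y' := by
  have := forces_imp.1 ((models_iff N NFU).1 hN _ NFU.orderedPair ![x, y, x', y']) (𝟙 T)
  rw [forces_and, forces_equal, forces_equal, forces_equal, eval_pair, eval_pair] at this
  simp only [eval_var, Category.id_comp] at this
  exact this H

/-- Comprehension: the set defined by a stratified formula exists on a cover. -/
theorem Models.exists_setOf (hN : N.Models NFU) {n : ℕ} {φ : Formula LSet (n + 1)}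
    (hφ : LSet.Stratified φ) {T : C} (h : Fin n → (T ⟶ N.carrier)) :
    ∃ (T' : C) (c : T' ⟶ T) (x : T' ⟶ N.carrier), IsCover c ∧
      ∀ {T'' : C} (a : T'' ⟶ T') (z : T'' ⟶ N.carrier),
        N.SetMem z (a ≫ x) ↔ N.Forces φ (extend (fun i => a ≫ c ≫ h i) z) := by
  obtain ⟨T', c, x, hc, H⟩ :=
    forces_ex.1 ((models_iff N NFU).1 hN _ (NFU.comprehension φ hφ) h)
  refine ⟨T', c, x, hc, fun {T''} a z => ?_⟩
  have := forces_iff.1 (forces_all.1 (forces_and.1 H).2 a z) (𝟙 _)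
  rw [forces_set_mem] at this
  simp only [Category.id_comp, comp_extend, forces_insertFresh, eval_var, extend_last,
    extend_castSucc] at this
  exact this

theorem Models.exists_set_of_NF (hN : N.Models NF) {T : C} (x : T ⟶ N.carrier) :
    ∃ s, s ≫ N.setsIncl = x := by
  have := (models_iff N NF).1 hN _ NF.allSets ![x]
  rw [LSet.allSets, forces_set_isSet] at this
  simpa using this

end CatStructure

end SetStructures

/-! ### Class formulas as set formulas -/

namespace LClass

/-- A term of the language of class theory, which is a variable, as a term of the language of set
theory. -/
def toSetTerm {n : ℕ} : LClass.Term (Fin n) → LSet.Term (Fin n)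
  | .var i => .var i
  | .func f _ => f.elim

/-- The atomic formulas of class theory, read in set theory: every element is in `Setom`, and the
classes are the sets. -/
def toSetRel {n : ℕ} : {l : ℕ} → ClassRelSymb l → (Fin l → LSet.Term (Fin n)) → Formula LSet n
  | _, .mem, ts => LSet.mem (ts 0) (ts 1)
  | _, .isSet, ts => LSet.isSet (ts 0)
  | _, .isClass, ts => LSet.isSet (ts 0)
  | _, .isSetom, ts => .equal (ts 0) (ts 0)
  | _, .pair, ts => .equal (LSet.pair (ts 0) (ts 1)) (ts 2)

/-- The formula of set theory that says of sets and atoms what `bound φ` says of them in class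
theory. -/
def toSet : {n : ℕ} → Formula LClass n → Formula LSet n
  | _, .falsum => .falsum
  | _, .equal t u => .equal (toSetTerm t) (toSetTerm u)
  | _, .rel R ts => toSetRel R fun i => toSetTerm (ts i)
  | _, .and φ ψ => .and (toSet φ) (toSet ψ)
  | _, .or φ ψ => .or (toSet φ) (toSet ψ)
  | _, .imp φ ψ => .imp (toSet φ) (toSet ψ)
  | _, .all φ => .all (toSet φ)
  | _, .ex φ => .ex (toSet φ)

theorem hasType_toSetTerm {n : ℕ} {s : Fin n → ℕ} {t : LClass.Term (Fin n)} {k : ℕ}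
    (H : HasType s t k) : HasType s (toSetTerm t) k := by
  cases t with
  | var i => exact H
  | func f ts => exact f.elim

theorem stratifiedBy_toSet {n : ℕ} {s : Fin n → ℕ} {φ : Formula LClass n}
    (H : StratifiedBy (L := LClass) typing s φ) :
    StratifiedBy (L := LSet) LSet.typing s (toSet φ) := by
  induction φ with
  | falsum => trivial
  | equal t u =>
    obtain ⟨k, h₁, h₂⟩ := H
    exact ⟨k, hasType_toSetTerm h₁, hasType_toSetTerm h₂⟩
  | rel R ts =>
    obtain ⟨k, hk, hR⟩ := H
    replace hk := fun i => hasType_toSetTerm (hk i)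
    cases R with
    | mem =>
      exact ⟨k, fun i => by fin_cases i <;> exact hk _, hR⟩
    | isSet => exact ⟨k, fun i => by fin_cases i; exact hk _, trivial⟩
    | isClass => exact ⟨k, fun i => by fin_cases i; exact hk _, trivial⟩
    | isSetom => exact ⟨k 0, hk 0, hk 0⟩
    | pair =>
      obtain ⟨e₁, e₂⟩ : k 0 = k 1 ∧ k 1 = k 2 := hR
      refine ⟨k 2, fun i => ?_, hk 2⟩
      fin_cases i
      · exact (e₁.trans e₂) ▸ hk 0
      · exact e₂ ▸ hk 1
  | and φ ψ ih₁ ih₂ => exact ⟨ih₁ H.1, ih₂ H.2⟩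
  | or φ ψ ih₁ ih₂ => exact ⟨ih₁ H.1, ih₂ H.2⟩
  | imp φ ψ ih₁ ih₂ => exact ⟨ih₁ H.1, ih₂ H.2⟩
  | all φ ih => exact H.imp fun _ h => ih h
  | ex φ ih => exact H.imp fun _ h => ih h

end LClass

/-! ### The class structure of a set-theoretic structure -/

section ClassStructures

attribute [local simp] prod.lift_fst prod.lift_snd prod.lift_fst_assoc prod.lift_snd_assoc

theorem factors_mk_piLift_one [HasFiniteLimits C] {X Y T : C} (f : X ⟶ Y) [Mono f]
    (k : Fin 1 → (T ⟶ Y)) :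
    (Subobject.mk (Pi.lift fun _ : Fin 1 => f)).Factors (Pi.lift k) ↔ ∃ x, x ≫ f = k 0 := by
  rw [factors_mk]
  refine exists_congr fun x => ⟨fun e => ?_, fun e => Pi.hom_ext _ _ fun i => ?_⟩
  · simpa using congrArg (· ≫ Pi.π _ 0) e
  · obtain rfl : i = 0 := Subsingleton.elim _ _
    simpa using e

theorem factors_mk_piLift_mem [HasFiniteLimits C] {A B D X T : C} (m : D ⟶ A ⨯ B) (f : A ⟶ X)
    (g : B ⟶ X) [Mono (Pi.lift ![m ≫ prod.fst ≫ f, m ≫ prod.snd ≫ g])] (k : Fin 2 → (T ⟶ X)) :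
    (Subobject.mk (Pi.lift ![m ≫ prod.fst ≫ f, m ≫ prod.snd ≫ g])).Factors (Pi.lift k) ↔
      ∃ z x, MemElem m z x ∧ z ≫ f = k 0 ∧ x ≫ g = k 1 := by
  rw [factors_mk]
  constructor
  · rintro ⟨q, hq⟩
    refine ⟨q ≫ m ≫ prod.fst, q ≫ m ≫ prod.snd, ⟨q, ?_⟩, ?_, ?_⟩
    · simpa using eq_lift (q ≫ m)
    · simpa using congrArg (· ≫ Pi.π _ 0) hq
    · simpa using congrArg (· ≫ Pi.π _ 1) hq
  · rintro ⟨z, x, ⟨q, hq⟩, hz, hx⟩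
    refine ⟨q, Pi.hom_ext _ _ fun i => ?_⟩
    fin_cases i
    · simpa [reassoc_of% hq] using hz
    · simpa [reassoc_of% hq] using hx

theorem factors_mk_piLift_pair [HasFiniteLimits C] {A X T : C} (p : A ⨯ A ⟶ A) (f : A ⟶ X)
    [Mono (Pi.lift ![prod.fst ≫ f, prod.snd ≫ f, p ≫ f])] (k : Fin 3 → (T ⟶ X)) :
    (Subobject.mk (Pi.lift ![prod.fst ≫ f, prod.snd ≫ f, p ≫ f])).Factors (Pi.lift k) ↔
      ∃ x y, x ≫ f = k 0 ∧ y ≫ f = k 1 ∧ (prod.lift x y ≫ p) ≫ f = k 2 := by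
  rw [factors_mk]
  constructor
  · rintro ⟨q, hq⟩
    refine ⟨q ≫ prod.fst, q ≫ prod.snd, ?_, ?_, ?_⟩
    · simpa using congrArg (· ≫ Pi.π _ 0) hq
    · simpa using congrArg (· ≫ Pi.π _ 1) hq
    · rw [← eq_lift]
      simpa using congrArg (· ≫ Pi.π _ 2) hq
  · rintro ⟨x, y, h₀, h₁, h₂⟩
    refine ⟨prod.lift x y, Pi.hom_ext _ _ fun i => ?_⟩
    fin_cases i
    · simpa using h₀
    · simpa using h₁
    · simpa using h₂

variable [IsTopos C]

namespace CatStructure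

variable {N : CatStructure C LSet} {PN mem M : C} {m : mem ⟶ N.carrier ⨯ PN}

/-- `χ` classifies membership exactly when it assigns to each set its elements. The factorisation of
the membership relation through `N ⨯ S^N` is automatic, as only sets have elements. -/
theorem classifiesMembership_iff [Mono m] (hN : N.Models NFU) {χ : N.sets ⟶ PN} :
    N.ClassifiesMembership m χ ↔ ∀ {T : C} (z : T ⟶ N.carrier) (s : T ⟶ N.sets),
      MemElem m z (s ≫ χ) ↔ N.SetMem z (s ≫ N.setsIncl) := by
  have := mono_memIncl (N := N)
  have key : ∀ {ε' : (N.rel SetRelSymb.mem : C) ⟶ N.carrier ⨯ N.sets},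
      ε' ≫ prod.map (𝟙 N.carrier) N.setsIncl = N.memIncl →
      ∀ {T : C} (z : T ⟶ N.carrier) (s : T ⟶ N.sets),
        (∃ q, q ≫ ε' = prod.lift z s) ↔ N.SetMem z (s ≫ N.setsIncl) := by
    intro ε' hε T z s
    refine exists_congr fun q => ?_
    rw [← hε, ← lift_map_id, ← Category.assoc, cancel_mono]
  constructor
  · rintro ⟨ε', t, hε, sq⟩ T z s
    have : Mono ε' := mono_of_mono_fac hε
    exact ((exists_isPullback_iff m ε' χ).1 ⟨t, sq⟩ z s).trans (key hε z s)
  · intro H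
    obtain ⟨s, hs⟩ := hN.exists_set_of_setMem (z := N.memIncl ≫ prod.fst)
      (x := N.memIncl ≫ prod.snd) ⟨𝟙 _, by rw [← eq_lift]; simp⟩
    have hε : prod.lift (N.memIncl ≫ prod.fst) s ≫ prod.map (𝟙 N.carrier) N.setsIncl =
        N.memIncl := by
      rw [lift_map_id, hs, ← eq_lift]
    have : Mono (prod.lift (N.memIncl ≫ prod.fst) s) := mono_of_mono_fac hε
    obtain ⟨t, sq⟩ := (exists_isPullback_iff m (prod.lift (N.memIncl ≫ prod.fst) s) χ).2
      fun z y => (H z y).trans (key hε z y).symm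
    exact ⟨_, t, hε, sq⟩

theorem existsUnique_classifiesMembership (hN : N.Models NFU) (hm : IsPowerObject m) :
    ∃! χ : N.sets ⟶ PN, N.ClassifiesMembership m χ := by
  have := hm.mono
  simp only [classifiesMembership_iff hN]
  have := mono_memIncl (N := N)
  let r := pullback.snd N.memIncl (prod.map (𝟙 N.carrier) N.setsIncl)
  have sq : IsPullback _ r N.memIncl _ :=
    IsPullback.of_hasPullback N.memIncl (prod.map (𝟙 N.carrier) N.setsIncl)
  obtain ⟨χ, hχ⟩ := hm.exists_classify r
  refine ⟨χ, fun {T} z s => ?_, fun χ' hχ' => hm.ext fun a x => ?_⟩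
  · rw [hχ]
    exact ((exists_isPullback_iff N.memIncl r N.setsIncl).1 ⟨_, sq⟩ z s).symm
  · rw [hχ', hχ]
    exact (exists_isPullback_iff N.memIncl r N.setsIncl).1 ⟨_, sq⟩ x a

/-- The morphism that assigns to each set its extension is monic, by extensionality. -/
theorem mono_of_classifiesMembership [Mono m] (hN : N.Models NFU) {χ : N.sets ⟶ PN}
    (hχ : N.ClassifiesMembership m χ) : Mono χ := by
  refine ⟨fun s s' e => hN.set_ext fun a z => ?_⟩
  rw [classifiesMembership_iff hN] at hχ
  have h₁ := hχ z (a ≫ s)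
  have h₂ := hχ z (a ≫ s')
  simp only [Category.assoc] at h₁ h₂
  rw [← h₁, ← h₂, e]

/-- `K` is a structure for class theory in which `iS : N ⟶ K` and `iC : PN ⟶ K` embed the sets and
atoms of `N` and the classes of them, so that the sets, identified with their extensions by `χ`,
are the classes in `Setom`. All relations are described by their generalised elements. -/
structure IsClassExtension (N : CatStructure C LSet) (m : mem ⟶ N.carrier ⨯ PN) (χ : N.sets ⟶ PN)
    (K : CatStructure C LClass) (iS : N.carrier ⟶ K.carrier) (iC : PN ⟶ K.carrier) : Prop where
  mono_setom : Mono iS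
  mono_class : Mono iC
  isPullback : IsPullback N.setsIncl χ iS iC
  classifies : ∀ {T : C} (z : T ⟶ N.carrier) (s : T ⟶ N.sets),
    MemElem m z (s ≫ χ) ↔ N.SetMem z (s ≫ N.setsIncl)
  rel_mem : ∀ {T : C} (k : Fin 2 → (T ⟶ K.carrier)),
    (K.rel ClassRelSymb.mem).Factors (Pi.lift k) ↔
      ∃ z x, MemElem m z x ∧ z ≫ iS = k 0 ∧ x ≫ iC = k 1
  rel_isSet : ∀ {T : C} (k : Fin 1 → (T ⟶ K.carrier)),
    (K.rel ClassRelSymb.isSet).Factors (Pi.lift k) ↔ ∃ s, s ≫ N.setsIncl ≫ iS = k 0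
  rel_isClass : ∀ {T : C} (k : Fin 1 → (T ⟶ K.carrier)),
    (K.rel ClassRelSymb.isClass).Factors (Pi.lift k) ↔ ∃ x, x ≫ iC = k 0
  rel_isSetom : ∀ {T : C} (k : Fin 1 → (T ⟶ K.carrier)),
    (K.rel ClassRelSymb.isSetom).Factors (Pi.lift k) ↔ ∃ x, x ≫ iS = k 0
  rel_pair : ∀ {T : C} (k : Fin 3 → (T ⟶ K.carrier)),
    (K.rel ClassRelSymb.pair).Factors (Pi.lift k) ↔
      ∃ x y, x ≫ iS = k 0 ∧ y ≫ iS = k 1 ∧ (prod.lift x y ≫ N.pairing) ≫ iS = k 2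

theorem isClassExtension_classStructure [Mono m] (hN : N.Models NFU) {χ : N.sets ⟶ PN}
    (hχ : N.ClassifiesMembership m χ) {mSetom : N.carrier ⟶ M} {mC : PN ⟶ M} [Mono mSetom]
    [Mono mC] (sq : IsPullback N.setsIncl χ mSetom mC) :
    IsClassExtension N m χ (N.classStructure m mSetom mC) mSetom mC where
  mono_setom := ‹_›
  mono_class := ‹_›
  isPullback := sq
  classifies := (classifiesMembership_iff hN).1 hχ
  rel_isSet k := factors_mk_piLift_one (N.setsIncl ≫ mSetom) k
  rel_isClass k := factors_mk_piLift_one mC k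
  rel_isSetom k := factors_mk_piLift_one mSetom k
  rel_mem k := factors_mk_piLift_mem m mSetom mC k
  rel_pair k := factors_mk_piLift_pair N.pairing mSetom k

namespace IsClassExtension

variable {χ : N.sets ⟶ PN} {K : CatStructure C LClass} {iS : N.carrier ⟶ K.carrier}
  {iC : PN ⟶ K.carrier}

section Atoms

variable {n : ℕ} {T : C} {h : Fin n → (T ⟶ K.carrier)} {t t' t'' : LClass.Term (Fin n)}

theorem forces_isSetom (E : IsClassExtension N m χ K iS iC) :
    K.Forces (LClass.isSetom t) h ↔ ∃ x, x ≫ iS = K.eval t h :=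
  forces_rel.trans (E.rel_isSetom _)

theorem forces_isClass (E : IsClassExtension N m χ K iS iC) :
    K.Forces (LClass.isClass t) h ↔ ∃ x, x ≫ iC = K.eval t h :=
  forces_rel.trans (E.rel_isClass _)

theorem forces_isSet (E : IsClassExtension N m χ K iS iC) :
    K.Forces (LClass.isSet t) h ↔ ∃ s, s ≫ N.setsIncl ≫ iS = K.eval t h :=
  forces_rel.trans (E.rel_isSet _)

theorem forces_mem (E : IsClassExtension N m χ K iS iC) :
    K.Forces (LClass.mem t t') h ↔
      ∃ z x, MemElem m z x ∧ z ≫ iS = K.eval t h ∧ x ≫ iC = K.eval t' h :=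
  forces_rel.trans (E.rel_mem _)

theorem forces_pair (E : IsClassExtension N m χ K iS iC) :
    K.Forces (LClass.pair t t' t'') h ↔ ∃ x y, x ≫ iS = K.eval t h ∧ y ≫ iS = K.eval t' h ∧
      (prod.lift x y ≫ N.pairing) ≫ iS = K.eval t'' h :=
  forces_rel.trans (E.rel_pair _)

end Atoms

/-- The classes in `Setom` are the sets, since the pushout square is a pullback. -/
theorem exists_class_iff_exists_set (E : IsClassExtension N m χ K iS iC) {T : C}
    (x : T ⟶ N.carrier) :
    (∃ p, p ≫ iC = x ≫ iS) ↔ ∃ s, s ≫ N.setsIncl = x := by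
  constructor
  · rintro ⟨p, hp⟩
    exact ⟨E.isPullback.lift x p hp.symm, E.isPullback.lift_fst _ _ _⟩
  · rintro ⟨s, rfl⟩
    exact ⟨s ≫ χ, by rw [Category.assoc, Category.assoc, E.isPullback.w]⟩

/-- Between sets and atoms, membership in the class structure is the original membership. -/
theorem mem_iff_setMem (E : IsClassExtension N m χ K iS iC) (hN : N.Models NFU) {T : C}
    (z x : T ⟶ N.carrier) :
    (∃ z' x', MemElem m z' x' ∧ z' ≫ iS = z ≫ iS ∧ x' ≫ iC = x ≫ iS) ↔ N.SetMem z x := by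
  have := E.mono_setom
  constructor
  · rintro ⟨z', p, hzp, hz, hp⟩
    obtain rfl := (cancel_mono iS).1 hz
    rw [← E.isPullback.lift_snd x p hp.symm, E.classifies, E.isPullback.lift_fst] at hzp
    exact hzp
  · intro H
    obtain ⟨s, rfl⟩ := hN.exists_set_of_setMem H
    exact ⟨z, s ≫ χ, (E.classifies z s).2 H, rfl,
      by rw [Category.assoc, Category.assoc, E.isPullback.w]⟩

theorem eval_toSetTerm {n : ℕ} (t : LClass.Term (Fin n)) {T : C} (h : Fin n → (T ⟶ N.carrier)) :
    K.eval t (fun i => h i ≫ iS) = N.eval (LClass.toSetTerm t) h ≫ iS := by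
  cases t with
  | var i =>
    change K.eval (var i) _ = N.eval (var i) h ≫ iS
    rw [eval_var, eval_var]
  | func f ts => exact f.elim

/-- On sets and atoms, a formula with quantifiers bounded to `Setom` means in the class structure
what its translation means in the set-theoretic structure. -/
theorem forces_bound_iff (E : IsClassExtension N m χ K iS iC) (hN : N.Models NFU) {n : ℕ}
    (φ : Formula LClass n) {T : C} (h : Fin n → (T ⟶ N.carrier)) :
    K.Forces (LClass.bound φ) (fun i => h i ≫ iS) ↔ N.Forces (LClass.toSet φ) h := by
  have := E.mono_setom
  have comp : ∀ {n : ℕ} {T T' : C} (h : Fin n → (T ⟶ N.carrier)) (a : T' ⟶ T),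
      (fun i => a ≫ h i ≫ iS) = fun i => (a ≫ h i) ≫ iS := by
    intros; simp
  induction φ generalizing T with
  | falsum => exact forces_falsum.trans forces_falsum.symm
  | equal t u =>
    rw [LClass.bound, LClass.toSet, forces_equal, forces_equal, eval_toSetTerm, eval_toSetTerm,
      cancel_mono]
  | rel R ts =>
    cases R with
    | mem =>
      refine forces_rel.trans ((E.rel_mem _).trans ?_)
      rw [eval_toSetTerm, eval_toSetTerm]
      exact (E.mem_iff_setMem hN _ _).trans forces_set_mem.symm
    | isSet =>
      refine forces_rel.trans ((E.rel_isSet _).trans (Iff.trans ?_ forces_set_isSet.symm))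
      rw [eval_toSetTerm]
      simp only [← Category.assoc, cancel_mono]
    | isClass =>
      refine forces_rel.trans ((E.rel_isClass _).trans (Iff.trans ?_ forces_set_isSet.symm))
      rw [eval_toSetTerm]
      exact E.exists_class_iff_exists_set _
    | isSetom =>
      exact iff_of_true (forces_rel.2 ((E.rel_isSetom _).2 ⟨_, (eval_toSetTerm _ h).symm⟩))
        (forces_equal.2 rfl)
    | pair =>
      refine forces_rel.trans ((E.rel_pair _).trans (Iff.trans ?_ forces_equal.symm))
      rw [eval_toSetTerm, eval_toSetTerm, eval_toSetTerm, eval_pair]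
      simp only [cancel_mono]
      constructor
      · rintro ⟨x, y, rfl, rfl, e⟩
        exact e
      · intro e
        exact ⟨_, _, rfl, rfl, e⟩
  | and φ ψ ih₁ ih₂ =>
    exact forces_and.trans ((and_congr (ih₁ h) (ih₂ h)).trans forces_and.symm)
  | or φ ψ ih₁ ih₂ =>
    rw [LClass.bound, LClass.toSet, forces_or, forces_or]
    simp only [comp, ih₁, ih₂]
  | imp φ ψ ih₁ ih₂ =>
    rw [LClass.bound, LClass.toSet, forces_imp, forces_imp]
    simp only [comp, ih₁, ih₂]
  | all φ ih =>
    rw [LClass.bound, LClass.toSet, forces_all, forces_all]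
    constructor
    · intro H T' a x
      have := forces_imp.1 (H a (x ≫ iS)) (𝟙 _)
      simp only [Category.id_comp, comp, ← extend_comp, ih] at this
      refine this (E.forces_isSetom.2 ⟨x, ?_⟩)
      rw [eval_var, extend_last]
    · intro H T' a x
      rw [forces_imp]
      intro T'' b hb
      obtain ⟨y, hy⟩ := E.forces_isSetom.1 hb
      rw [eval_var, extend_last] at hy
      have e : (fun i => b ≫ extend (fun i => a ≫ h i ≫ iS) x i) =
          fun i => extend (fun i => (b ≫ a) ≫ h i) y i ≫ iS := by
        rw [extend_comp, hy, comp_extend]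
        simp
      rw [e]
      exact (ih _).2 (H _ _)
  | ex φ ih =>
    rw [LClass.bound, LClass.toSet, forces_ex, forces_ex]
    refine exists_congr fun T' => exists_congr fun c => ?_
    constructor
    · rintro ⟨x, hc, H⟩
      obtain ⟨H₁, H₂⟩ := forces_and.1 H
      obtain ⟨y, hy⟩ := E.forces_isSetom.1 H₁
      rw [eval_var, extend_last] at hy
      refine ⟨y, hc, (ih _).1 ?_⟩
      rw [extend_comp, hy]
      simpa using H₂
    · rintro ⟨x, hc, H⟩
      refine ⟨x ≫ iS, hc, ?_⟩
      rw [comp, ← extend_comp]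
      refine forces_and.2 ⟨E.forces_isSetom.2 ⟨x, ?_⟩, (ih _).2 H⟩
      rw [eval_var, extend_last]

end IsClassExtension

end CatStructure

end ClassStructures

/-! ### The axioms of class theory -/

section Axioms

attribute [local simp] prod.lift_fst prod.lift_snd prod.lift_fst_assoc prod.lift_snd_assoc

variable [IsTopos C]

namespace CatStructure.IsClassExtension

variable {N : CatStructure C LSet} {PN mem : C} {m : mem ⟶ N.carrier ⨯ PN} {χ : N.sets ⟶ PN}
  {K : CatStructure C LClass} {iS : N.carrier ⟶ K.carrier} {iC : PN ⟶ K.carrier} {T : C}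

theorem forces_classhood (E : IsClassExtension N m χ K iS iC) (h : Fin 2 → (T ⟶ K.carrier)) :
    K.Forces LClass.classhood h := by
  refine forces_imp.2 fun a H => ?_
  obtain ⟨z, x, -, -, hx⟩ := E.forces_mem.1 H
  exact E.forces_isClass.2 ⟨x, hx⟩

theorem forces_setomhood (E : IsClassExtension N m χ K iS iC) (h : Fin 2 → (T ⟶ K.carrier)) :
    K.Forces LClass.setomhood h := by
  refine forces_imp.2 fun a H => ?_
  obtain ⟨z, x, -, hz, -⟩ := E.forces_mem.1 H
  exact E.forces_isSetom.2 ⟨z, hz⟩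

theorem forces_extensionality (E : IsClassExtension N m χ K iS iC) (hm : IsPowerObject m)
    (h : Fin 2 → (T ⟶ K.carrier)) : K.Forces LClass.extensionality h := by
  have := E.mono_setom
  have := E.mono_class
  refine forces_imp.2 fun {T'} a H => forces_equal.2 ?_
  obtain ⟨H₀, H⟩ := forces_and.1 H
  obtain ⟨H₁, H⟩ := forces_and.1 H
  obtain ⟨x, hx⟩ := E.forces_isClass.1 H₀
  obtain ⟨y, hy⟩ := E.forces_isClass.1 H₁
  rw [← hx, ← hy]
  rw [eval_var] at hx hy
  congr 1
  refine hm.ext fun {T''} b z => ?_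
  have iff := forces_iff.1 (forces_all.1 H b (z ≫ iS)) (𝟙 _)
  rw [E.forces_mem, E.forces_mem, eval_var, eval_var, eval_var] at iff
  have e : ∀ (w : T' ⟶ PN) (i : Fin 2), w ≫ iC = a ≫ h i →
      (MemElem m z (b ≫ w) ↔ ∃ z' x', MemElem m z' x' ∧ z' ≫ iS = z ≫ iS ∧
        x' ≫ iC = b ≫ a ≫ h i) := by
    intro w i hw
    constructor
    · intro hz
      exact ⟨z, b ≫ w, hz, rfl, by rw [Category.assoc, hw]⟩
    · rintro ⟨z', x', hz, e₁, e₂⟩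
      rw [← hw, ← Category.assoc] at e₂
      rwa [(cancel_mono iS).1 e₁, (cancel_mono iC).1 e₂] at hz
  rw [e x 0 hx, e y 1 hy]
  simp only [Category.id_comp] at iff
  exact iff

/-- Every formula defines a class, namely the one named by the morphism that classifies the
interpretation of the formula. -/
theorem forces_classComprehension (E : IsClassExtension N m χ K iS iC) (hm : IsPowerObject m)
    {n : ℕ} (φ : Formula LClass (n + 1)) (h : Fin n → (T ⟶ K.carrier)) :
    K.Forces (LClass.classComprehension φ) h := by
  have := E.mono_setom
  have := E.mono_class
  -- the pairs `(z, t)` such that `φ` holds of the parameters at `t` and of `z`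
  let R := (Subobject.pullback (Pi.lift (extend
    (fun i => (prod.snd : N.carrier ⨯ T ⟶ T) ≫ h i) (prod.fst ≫ iS)))).obj (K.interp φ)
  obtain ⟨x, hx⟩ := hm.exists_classify R.arrow
  have hx' : ∀ {T' : C} (z : T' ⟶ N.carrier) (a : T' ⟶ T), MemElem m z (a ≫ x) ↔
      K.Forces φ (extend (fun i => a ≫ h i) (z ≫ iS)) := by
    intro T' z a
    rw [hx, ← factors_mk, Subobject.mk_arrow, factors_pullback, comp_piLift, comp_extend]
    simp [Forces]
  refine forces_ex_of (x ≫ iC) (forces_and.2 ⟨E.forces_isClass.2 ⟨x, ?_⟩, ?_⟩)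
  · rw [eval_var, extend_last]
  · refine forces_all.2 fun a z => forces_imp.2 fun b hb => forces_iff.2 fun c => ?_
    obtain ⟨z', hz'⟩ := E.forces_isSetom.1 hb
    rw [eval_var, extend_last] at hz'
    rw [E.forces_mem]
    simp only [comp_extend, comp_comp_extend, forces_insertFresh, eval_var, extend_last,
      extend_castSucc]
    have e := hx' (c ≫ z') (c ≫ b ≫ a)
    simp only [Category.assoc, hz'] at e
    rw [← e]
    constructor
    · rintro ⟨z₁, x₁, H, e₁, e₂⟩
      rw [← hz', ← Category.assoc, cancel_mono] at e₁
      have e₃ : x₁ = c ≫ b ≫ a ≫ x := by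
        rw [← cancel_mono iC, e₂]
        simp
      rwa [e₁, e₃] at H
    · intro H
      exact ⟨_, _, H, by rw [Category.assoc, hz'], by simp⟩

/-- Set comprehension for a bounded stratified formula is comprehension in `N` for its
translation. -/
theorem forces_setComprehension (E : IsClassExtension N m χ K iS iC) (hN : N.Models NFU)
    {n : ℕ} {φ : Formula LClass (n + 1)} (hφ : LClass.Stratified φ)
    (h : Fin n → (T ⟶ K.carrier)) :
    K.Forces (LClass.setComprehension (LClass.bound φ)) h := by
  have := E.mono_setom
  refine forces_imp.2 fun {T₀} a H => ?_
  rw [forces_conj] at H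
  choose y hy using fun i => E.forces_isSetom.1 (H i)
  simp only [eval_var] at hy
  obtain ⟨s, hs⟩ := hφ
  obtain ⟨T₁, c, x, hc, hx⟩ := hN.exists_setOf ⟨s, LClass.stratifiedBy_toSet hs⟩ y
  refine forces_ex.2 ⟨T₁, c, x ≫ iS, hc, forces_and.2 ⟨E.forces_isSetom.2 ⟨x, ?_⟩, ?_⟩⟩
  · rw [eval_var, extend_last]
  · refine forces_all.2 fun {T₂} b z => forces_imp.2 fun {T₃} d hd => forces_iff.2 fun {T₄} f => ?_
    obtain ⟨z', hz'⟩ := E.forces_isSetom.1 hd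
    rw [eval_var, extend_last] at hz'
    rw [E.forces_mem]
    simp only [comp_extend, comp_comp_extend, forces_insertFresh, eval_var, extend_last,
      extend_castSucc]
    have e₁ := E.mem_iff_setMem hN (f ≫ z') (f ≫ d ≫ b ≫ x)
    have e₂ := hx (f ≫ d ≫ b) (f ≫ z')
    simp only [Category.assoc] at e₁ e₂
    rw [e₂, ← E.forces_bound_iff hN, extend_comp] at e₁
    simpa only [Category.assoc, hz', hy] using e₁

theorem forces_orderedPair (E : IsClassExtension N m χ K iS iC) (hN : N.Models NFU)
    (h : Fin 4 → (T ⟶ K.carrier)) : K.Forces LClass.orderedPair h := by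
  have := E.mono_setom
  refine forces_imp.2 fun {T'} a H => forces_iff.2 fun {T''} b => ?_
  rw [forces_conj] at H
  choose y hy using fun i => E.forces_isSetom.1 (H i)
  simp only [eval_var] at hy
  rw [forces_and, forces_equal, forces_equal, forces_ex]
  simp only [eval_var]
  have hy' : ∀ {S : C} (c : S ⟶ T'') (i : Fin 4), (c ≫ b ≫ y i) ≫ iS = c ≫ b ≫ a ≫ h i := by
    intro S c i
    simp [hy]
  constructor
  · rintro ⟨S, c, w, hc, H'⟩
    obtain ⟨H₁, H₂⟩ := forces_and.1 H'
    obtain ⟨x₁, x₂, e₁, e₂, e₃⟩ := E.forces_pair.1 H₁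
    obtain ⟨x₃, x₄, e₄, e₅, e₆⟩ := E.forces_pair.1 H₂
    have inj := hN.pair_injective ((cancel_mono iS).1 (e₃.trans e₆.symm))
    rw [eval_var] at e₁ e₂ e₄ e₅
    refine ⟨hc.hom_ext ?_, hc.hom_ext ?_⟩
    · exact e₁.symm.trans ((congrArg (· ≫ iS) inj.1).trans e₄)
    · exact e₂.symm.trans ((congrArg (· ≫ iS) inj.2).trans e₅)
  · rintro ⟨e₁, e₂⟩
    have eval_last : ∀ (k : Fin 4 → (T'' ⟶ K.carrier)) w, K.eval (var 4) (extend k w) = w :=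
      fun k w => (eval_var _).trans (extend_last k w)
    refine ⟨T'', 𝟙 _, (prod.lift (b ≫ y 0) (b ≫ y 1) ≫ N.pairing) ≫ iS, isCover_id _,
      forces_and.2 ⟨E.forces_pair.2 ⟨b ≫ y 0, b ≫ y 1, ?_, ?_, (eval_last _ _).symm⟩,
        E.forces_pair.2 ⟨b ≫ y 0, b ≫ y 1, ?_, ?_, (eval_last _ _).symm⟩⟩⟩ <;>
      rw [eval_var] <;> rw [← Category.id_comp (b ≫ y _), hy']
    · rfl
    · rfl
    · exact congrArg (𝟙 _ ≫ ·) e₁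
    · exact congrArg (𝟙 _ ≫ ·) e₂

theorem forces_pairFunctional (E : IsClassExtension N m χ K iS iC) (h : Fin 4 → (T ⟶ K.carrier)) :
    K.Forces LClass.pairFunctional h := by
  have := E.mono_setom
  refine forces_imp.2 fun a H => forces_equal.2 ?_
  obtain ⟨H₁, H₂⟩ := forces_and.1 H
  obtain ⟨x, y, e₁, e₂, e₃⟩ := E.forces_pair.1 H₁
  obtain ⟨x', y', e₁', e₂', e₃'⟩ := E.forces_pair.1 H₂
  rw [← e₁', cancel_mono] at e₁
  rw [← e₂', cancel_mono] at e₂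
  rw [← e₃, ← e₃', e₁, e₂]

theorem forces_setIffSetomClass (E : IsClassExtension N m χ K iS iC)
    (h : Fin 1 → (T ⟶ K.carrier)) : K.Forces LClass.setIffSetomClass h := by
  refine forces_iff.2 fun a => ?_
  rw [forces_and, E.forces_isSet, E.forces_isSetom, E.forces_isClass]
  constructor
  · rintro ⟨s, hs⟩
    exact ⟨⟨s ≫ N.setsIncl, by simpa using hs⟩, s ≫ χ, by simpa [E.isPullback.w] using hs⟩
  · rintro ⟨⟨x, hx⟩, hp⟩
    rw [← hx] at hp ⊢
    obtain ⟨s, rfl⟩ := (E.exists_class_iff_exists_set x).1 hp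
    exact ⟨s, by simp⟩

theorem forces_allSets (E : IsClassExtension N m χ K iS iC) (hN : N.Models NF)
    (h : Fin 1 → (T ⟶ K.carrier)) : K.Forces LClass.allSets h := by
  refine forces_imp.2 fun a H => ?_
  obtain ⟨x, hx⟩ := E.forces_isSetom.1 H
  obtain ⟨s, rfl⟩ := hN.exists_set_of_NF x
  exact E.forces_isSet.2 ⟨s, by simpa using hx⟩

theorem models_MLU (E : IsClassExtension N m χ K iS iC) (hm : IsPowerObject m)
    (hN : N.Models NFU) : K.Models MLU := by
  rw [models_iff]
  rintro n φ hφ T h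
  cases hφ with
  | classhood => exact E.forces_classhood h
  | setomhood => exact E.forces_setomhood h
  | extensionality => exact E.forces_extensionality hm h
  | classComprehension φ => exact E.forces_classComprehension hm φ h
  | setComprehension φ hφ => exact E.forces_setComprehension hN hφ h
  | orderedPair => exact E.forces_orderedPair hN h
  | pairFunctional => exact E.forces_pairFunctional h
  | setIffSetomClass => exact E.forces_setIffSetomClass h

theorem models_ML (E : IsClassExtension N m χ K iS iC) (hm : IsPowerObject m)
    (hN : N.Models NF) : K.Models ML := by
  rw [models_iff]
  rintro n φ hφ T h
  cases hφ with
  | ofMLU φ hφ =>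
    exact (models_iff K MLU).1 (E.models_MLU hm fun _ φ hφ => hN φ (.ofNFU φ hφ)) φ hφ h
  | allSets => exact E.forces_allSets hN h

end CatStructure.IsClassExtension

end Axioms

end NFTopos

theorem mainTheorem5 {E : Type u} [Category.{w} E] [IsTopos E] :
    -- existence of models, for each of the four pairs of theories
    ((∃ N : CatStructure E LSet, N.Models NFU) → ∃ M : CatStructure E LClass, M.Models MLU) ∧
    ((∃ N : CatStructure E LSet, N.Models NF) → ∃ M : CatStructure E LClass, M.Models ML) ∧
    ((∃ N : CatStructure E LSet, N.ModelsClassically NFU) →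
      ∃ M : CatStructure E LClass, M.ModelsClassically MLU) ∧
    ((∃ N : CatStructure E LSet, N.ModelsClassically NF) →
      ∃ M : CatStructure E LClass, M.ModelsClassically ML) ∧
    -- the construction of the model
    (∀ N : CatStructure E LSet, N.Models NFU →
      ∀ {PN mem : E} (m : mem ⟶ N.carrier ⨯ PN) [Mono m], IsPowerObject m →
        (∃! χ : N.sets ⟶ PN, N.ClassifiesMembership m χ) ∧
        ∀ χ : N.sets ⟶ PN, N.ClassifiesMembership m χ →
          Mono χ ∧ HasPushout N.setsIncl χ ∧
          ∀ {M : E} (mSetom : N.carrier ⟶ M) (mC : PN ⟶ M),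
            IsPushout N.setsIncl χ mSetom mC →
            ∃ (_ : Mono mSetom) (_ : Mono mC),
              (N.classStructure m mSetom mC).Models MLU ∧
              (N.Models NF → (N.classStructure m mSetom mC).Models ML)) := by
  have construction : ∀ N : CatStructure E LSet, N.Models NFU →
      ∀ {PN mem : E} (m : mem ⟶ N.carrier ⨯ PN) [Mono m], IsPowerObject m →
        (∃! χ : N.sets ⟶ PN, N.ClassifiesMembership m χ) ∧
        ∀ χ : N.sets ⟶ PN, N.ClassifiesMembership m χ →
          Mono χ ∧ HasPushout N.setsIncl χ ∧
          ∀ {M : E} (mSetom : N.carrier ⟶ M) (mC : PN ⟶ M),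
            IsPushout N.setsIncl χ mSetom mC →
            ∃ (_ : Mono mSetom) (_ : Mono mC),
              (N.classStructure m mSetom mC).Models MLU ∧
              (N.Models NF → (N.classStructure m mSetom mC).Models ML) := by
    intro N hN PN mem m _ hm
    refine ⟨CatStructure.existsUnique_classifiesMembership hN hm, fun χ hχ => ?_⟩
    have := CatStructure.mono_of_classifiesMembership hN hχ
    refine ⟨this, hasPushout_of_mono _ _, fun {M} mSetom mC po => ?_⟩
    obtain ⟨mS, mC', sq⟩ := mono_mono_isPullback_of_isPushout po
    have ext := CatStructure.isClassExtension_classStructure hN hχ sq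
    exact ⟨mS, mC', ext.models_MLU hm hN, ext.models_ML hm⟩
  have existence : ∀ N : CatStructure E LSet, N.Models NFU →
      ∃ M : CatStructure E LClass, M.Models MLU ∧ (N.Models NF → M.Models ML) := by
    intro N hN
    obtain ⟨PN, mem, m, hm⟩ := IsTopos.exists_powerObject N.carrier
    have := hm.mono
    obtain ⟨⟨χ, hχ, -⟩, H⟩ := construction N hN m hm
    obtain ⟨-, _, H⟩ := H χ hχ
    obtain ⟨_, _, H⟩ := H _ _ (IsPushout.of_hasPushout N.setsIncl χ)
    exact ⟨_, H⟩
  have ofNF : ∀ {N : CatStructure E LSet}, N.Models NF → N.Models NFU :=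
    fun hN _ φ hφ => hN φ (.ofNFU φ hφ)
  refine ⟨?_, ?_, ?_, ?_, construction⟩
  · rintro ⟨N, hN⟩
    obtain ⟨M, hM, -⟩ := existence N hN
    exact ⟨M, hM⟩
  · rintro ⟨N, hN⟩
    obtain ⟨M, -, hM⟩ := existence N (ofNF hN)
    exact ⟨M, hM hN⟩
  · rintro ⟨N, hE, hN⟩
    obtain ⟨M, hM, -⟩ := existence N hN
    exact ⟨M, hE, hM⟩
  · rintro ⟨N, hE, hN⟩
    obtain ⟨M, -, hM⟩ := existence N (ofNF hN)
    exact ⟨M, hE, hM hN⟩
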